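/- Let $d\in\mathbb N$, $T>0$, $1\le p<p'<\infty$, and let $C_T=C([0,T],\mathbb R^d)$ carry the supremum norm $\|\cdot\|_\infty$. For a separable Banach space $E$ let $\mathcal P_p(E)$ be the set of Borel probability measures on $E$ with finite $p$-th moment, and let $\mathcal W_{E,p}(\mu,\nu)=\big(\inf_m\int_{E\times E}\|x-y\|^p\,m(dx,dy)\big)^{1/p}$ be the $p$-Wasserstein distance, the infimum being over all couplings $m$ of $\mu$ and $\nu$. For $y^1,\dots,y^N\in E$ put $L^N(y^{(N)})=\frac1N\sum_{i=1}^N\delta_{y^i}$. Let $b:[0,T]\times\mathbb R^d\times\mathcal P_p(\mathbb R^d)\to\mathbb R^d$ be Borel measurable, and assume that there is a constant $K_b$ with $$|b(t,x,\mu)-b(t,x',\mu')|^p\le K_b\big(|x-x'|^p+\mathcal W_{\mathbb R^d,p}(\mu,\mu')^p\big)\qquad\text{for all } t\in[0,T],\ x,x'\in\mathbb R^d,\ \mu,\mu'\in\mathcal P_p(\mathbb R^d),$$ and that $t\mapsto b(t,x,\mu)$ is Lebesgue integrable on $[0,T]$ for some (equivalently, every) $(x,\mu)$. On a probability space $(\bar\Omega,\bar{\mathcal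 A},\bar{\mathbb P})$ let $(\zeta^i)_{i\ge1}\subset L^{p'}(\bar\Omega,\mathbb R^d)$ and $(W^i)_{i\ge1}\subset L^{p'}(\bar\Omega,C_T)$ be two sequences of i.i.d. random variables, independent of each other. Let $\bar\zeta$ be distributed as $\zeta^1$, and let $\bar W$ be distributed as $W^1$ and independent of $\bar\zeta$. Let $B\in L^p(\bar\Omega,C_T)$ be independent of $\big((\zeta^i)_i,(W^i)_i,\bar\zeta,\bar W\big)$. (Neither the $W^i$ nor $B$ need be Brownian motions.) Then for every $N\ge1$ there is a solution $X^{(N)}=(X^{1,N},\dots,X^{N,N})\in L^p(\bar\Omega,(C_T)^N)$ of the particle system with common noise: $\bar{\mathbb P}$-a.s., for all $i\le N$ and all $t\in[0,T]$, $$X^{i,N}_t=\zeta^i+\int_0^t b\big(s,X^{i,N}_s,L^N(X^{(N)}_s)\big)\,ds+W^i_t+B_t .$$ There is also a solution $\bar X\in L^p(\bar\Omega,C_T)$ of the conditional McKean–Vlasov equation: $\bar{\mathbb P}$-a.s., for all $t\in[0,T]$, $$\bar X_t=\bar\zeta+\int_0^t b\big(s,\bar X_s,\mathcal L(\bar X_s\mid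 B)\big)\,ds+\bar W_t+B_t ,$$ where $\mathcal L(\bar X\mid B)$ is the regular conditional law of $\bar X$ given $B$ on $C_T$ and $\mathcal L(\bar X_s\mid B)$ is its marginal at time $s$. Moreover, for all such solutions $X^{(N)}$ ($N\ge1$) and $\bar X$, $$\mathcal W_{C_T,p}\big(L^N(X^{(N)}),\mathcal L(\bar X\mid B)\big)\longrightarrow 0\quad\text{as }N\to\infty,\qquad\bar{\mathbb P}\text{-a.s.}$$ -/

import Mathlib

open MeasureTheory ProbabilityTheory Filter Topology
open scoped ENNReal NNReal

noncomputable section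

/-- The space `C_T = C([0,T], ℝ^d)`, with the supremum norm. -/
abbrev PathSpace (d : ℕ) (T : ℝ) : Type :=
  C(Set.Icc (0 : ℝ) T, EuclideanSpace ℝ (Fin d))

/-- Path space carries its Borel σ-algebra. -/
instance PathSpace.measurableSpace (d : ℕ) (T : ℝ) : MeasurableSpace (PathSpace d T) :=
  borel _

instance PathSpace.borelSpace (d : ℕ) (T : ℝ) : BorelSpace (PathSpace d T) := ⟨rfl⟩

/-- The `p`-Wasserstein distance, with values in `[0,∞]`: the `p`-th root of the infimum, over all
couplings `m` of `μ` and `ν`, of `∫ d(x,y)^p dm(x,y)`. -/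
def wasserstein {E : Type*} [PseudoEMetricSpace E] [MeasurableSpace E] (p : ℝ≥0)
    (μ ν : Measure E) : ℝ≥0∞ :=
  (⨅ (m : Measure (E × E)) (_ : m.map Prod.fst = μ ∧ m.map Prod.snd = ν),
    ∫⁻ z, edist z.1 z.2 ^ (p : ℝ) ∂m) ^ (1 / (p : ℝ))

/-- `𝒫_p(E)`: the probability measures on `E` with finite `p`-th moment. -/
structure PMeasure (p : ℝ≥0) (E : Type*) [NormedAddCommGroup E] [MeasurableSpace E] where
  /-- the underlying measure -/
  toMeasure : Measure E
  isProbabilityMeasure : IsProbabilityMeasure toMeasure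
  moment_lt_top : ∫⁻ x, ‖x‖ₑ ^ (p : ℝ) ∂toMeasure < ∞

section PMeasure

variable {E : Type*} [NormedAddCommGroup E] [MeasurableSpace E]

/-- The topology of the Wasserstein distance on `𝒫_p(E)`: a set is open when it contains, around
each of its points, a ball of positive radius. -/
instance PMeasure.topologicalSpace (p : ℝ≥0) : TopologicalSpace (PMeasure p E) where
  IsOpen U := ∀ μ ∈ U, ∃ ε : ℝ≥0∞, 0 < ε ∧
    ∀ ν : PMeasure p E, wasserstein p μ.toMeasure ν.toMeasure < ε → ν ∈ U
  isOpen_univ := fun _ _ => ⟨1, one_pos, fun _ _ => trivial⟩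
  isOpen_inter := by
    rintro U V hU hV μ ⟨hμU, hμV⟩
    obtain ⟨ε, hε, h⟩ := hU μ hμU
    obtain ⟨δ, hδ, h'⟩ := hV μ hμV
    exact ⟨min ε δ, lt_min hε hδ, fun ν hν =>
      ⟨h ν (hν.trans_le (min_le_left _ _)), h' ν (hν.trans_le (min_le_right _ _))⟩⟩
  isOpen_sUnion := by
    rintro S hS μ ⟨U, hU, hμ⟩
    obtain ⟨ε, hε, h⟩ := hS U hU μ hμ
    exact ⟨ε, hε, fun ν hν => ⟨U, hU, h ν hν⟩⟩

/-- `𝒫_p(E)` carries the Borel σ-algebra of the Wasserstein distance. -/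
instance PMeasure.measurableSpace (p : ℝ≥0) : MeasurableSpace (PMeasure p E) := borel _

instance PMeasure.borelSpace (p : ℝ≥0) : BorelSpace (PMeasure p E) := ⟨rfl⟩

end PMeasure

/-- The empirical measure `(1/N) ∑ δ_{y_i}` (used for `N ≥ 1`). -/
def empiricalMeasure {E : Type*} [MeasurableSpace E] {N : ℕ} (y : Fin N → E) : Measure E :=
  (N : ℝ≥0∞)⁻¹ • ∑ i, Measure.dirac (y i)

/-- The empirical measure of `N ≥ 1` points of `ℝ^d`, as an element of `𝒫_p(ℝ^d)`. -/
def empirical (p : ℝ≥0) {d N : ℕ} [NeZero N] (y : Fin N → EuclideanSpace ℝ (Fin d)) :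
    PMeasure p (EuclideanSpace ℝ (Fin d)) where
  toMeasure := empiricalMeasure y
  isProbabilityMeasure := by
    constructor
    simp [empiricalMeasure, ENNReal.inv_mul_cancel (Nat.cast_ne_zero.mpr (NeZero.ne N))
      (ENNReal.natCast_ne_top N)]
  moment_lt_top := by
    rw [empiricalMeasure, lintegral_smul_measure, lintegral_finsetSum_measure]
    refine ENNReal.mul_lt_top
      (ENNReal.inv_lt_top.mpr (Nat.cast_pos.mpr (NeZero.pos N))) ?_
    refine ENNReal.sum_lt_top.mpr fun i _ => ?_
    rw [lintegral_dirac]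
    exact ENNReal.rpow_lt_top_of_nonneg p.2 enorm_ne_top

/-- The marginal `μ_t`, the image under `γ ↦ γ(t)`, of a law `μ ∈ 𝒫_p(C_T)`. -/
def PMeasure.marginal {p : ℝ≥0} {d : ℕ} {T : ℝ} (μ : PMeasure p (PathSpace d T))
    (t : Set.Icc (0 : ℝ) T) : PMeasure p (EuclideanSpace ℝ (Fin d)) where
  toMeasure := μ.toMeasure.map (fun γ : PathSpace d T => γ t)
  isProbabilityMeasure := by
    have := μ.isProbabilityMeasure
    exact Measure.isProbabilityMeasure_map
      (continuous_eval_const t).measurable.aemeasurable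
  moment_lt_top := by
    rw [lintegral_map (by fun_prop) (continuous_eval_const t).measurable]
    refine lt_of_le_of_lt (lintegral_mono fun γ => ?_) μ.moment_lt_top
    refine ENNReal.rpow_le_rpow ?_ p.2
    rw [← ofReal_norm, ← ofReal_norm]
    exact ENNReal.ofReal_le_ofReal (γ.norm_coe_le_norm t)

/-- The standing assumption on the drift `b : [0,T] × ℝ^d × 𝒫_p(ℝ^d) → ℝ^d`: it is Borel
measurable and, uniformly in time, Lipschitz in space and measure. -/
structure DriftAssumption {p : ℝ≥0} {d : ℕ} {T : ℝ}
    (b : Set.Icc (0 : ℝ) T → EuclideanSpace ℝ (Fin d) →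
      PMeasure p (EuclideanSpace ℝ (Fin d)) → EuclideanSpace ℝ (Fin d)) : Prop where
  measurable : Measurable fun z : Set.Icc (0 : ℝ) T × EuclideanSpace ℝ (Fin d) ×
    PMeasure p (EuclideanSpace ℝ (Fin d)) => b z.1 z.2.1 z.2.2
  lipschitz : ∃ K : ℝ≥0, ∀ t x x' μ μ', ‖b t x μ - b t x' μ'‖ₑ ^ (p : ℝ) ≤
    K * (‖x - x'‖ₑ ^ (p : ℝ) + wasserstein p μ.toMeasure μ'.toMeasure ^ (p : ℝ))

/-- Lebesgue measure on the time interval `[0,T]`. -/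
def timeMeasure (T : ℝ) : Measure (Set.Icc (0 : ℝ) T) :=
  Measure.comap Subtype.val volume

/-- The path `x` satisfies `x_t = x₀ + ∫_0^t f(s) ds + w_t + β_t` for all `t ∈ [0,T]`, the
integral being a genuine Lebesgue integral. -/
def SolvesIntegralEq {d : ℕ} {T : ℝ} (x₀ : EuclideanSpace ℝ (Fin d))
    (f : Set.Icc (0 : ℝ) T → EuclideanSpace ℝ (Fin d)) (w β x : PathSpace d T) : Prop :=
  Integrable f (timeMeasure T) ∧
    ∀ t, x t = x₀ + (∫ s in Set.Iic t, f s ∂timeMeasure T) + w t + β t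

section Solutions

variable {Ω : Type*} [MeasurableSpace Ω] {p : ℝ≥0} {d : ℕ} {T : ℝ}

/-- `X = (X^1, …, X^N)` is an `L^p` solution of the particle system with common noise
`dX^i_t = b(t, X^i_t, (1/N) ∑_j δ_{X^j_t}) dt + dW^i_t + dB_t`, `X^i_0 = ζ^i`. -/
structure IsParticleSolution (P : Measure Ω)
    (b : Set.Icc (0 : ℝ) T → EuclideanSpace ℝ (Fin d) →
      PMeasure p (EuclideanSpace ℝ (Fin d)) → EuclideanSpace ℝ (Fin d))
    {N : ℕ} [NeZero N] (ζ : Fin N → Ω → EuclideanSpace ℝ (Fin d)) (W : Fin N → Ω → PathSpace d T)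
    (B : Ω → PathSpace d T) (X : Fin N → Ω → PathSpace d T) : Prop where
  measurable : ∀ i, Measurable (X i)
  memLp : ∀ i, MemLp (X i) p P
  solves : ∀ᵐ ω ∂P, ∀ i, SolvesIntegralEq (ζ i ω)
    (fun s => b s (X i ω s) (empirical p fun j => X j ω s)) (W i ω) (B ω) (X i ω)

/-- `X` is an `L^p` solution of the conditional McKean–Vlasov equation
`dX_t = b(t, X_t, ℒ(X_t | B)) dt + dW_t + dB_t`, `X_0 = ζ`, where `ℒ(X_t | B)` is the marginal at
time `t` of the regular conditional law `ℒ(X | B)` on path space. -/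
structure IsConditionalMcKeanVlasovSolution (P : Measure Ω) [IsFiniteMeasure P]
    (b : Set.Icc (0 : ℝ) T → EuclideanSpace ℝ (Fin d) →
      PMeasure p (EuclideanSpace ℝ (Fin d)) → EuclideanSpace ℝ (Fin d))
    (ζ : Ω → EuclideanSpace ℝ (Fin d)) (W B X : Ω → PathSpace d T) : Prop where
  measurable : Measurable X
  memLp : MemLp X p P
  solves : ∀ᵐ ω ∂P, ∃ μ : PMeasure p (PathSpace d T),
    μ.toMeasure = condDistrib X B P (B ω) ∧
    SolvesIntegralEq (ζ ω) (fun s => b s (X ω s) (μ.marginal s)) (W ω) (B ω) (X ω)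

end Solutions

end

/-! Write Y^i = ζ^i + W^i for the idiosyncratic input and m for its law. For almost every fixed ω
the particle system is itself a McKean–Vlasov equation: on {1,…,N} with the uniform measure, the law
of i ↦ X^{i,N}(ω) is the empirical measure, and the input is i ↦ Y^i(ω) + B(ω). Given B = β, the
limit equation is the same equation with input Y + β, where Y has law m. The theorem thus reduces to
one deterministic fact, `LipschitzDrift.wasserstein_le`: the law of the solution is a Lipschitz
function of the law of the input. Shifting both inputs by β preserves their distance, so the
distance to be estimated is at most a constant times the distance from L^N(Y^1,…,Y^N) to m. This
tends to zero by the law of large numbers in Wasserstein distance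
(`tendsto_wasserstein_empiricalMeasure`), whose almost sure event does not involve B.

Stability comes from solving both equations on one coupling of the inputs. Under the weight
e^{-4Lt}, integration in time gains a factor 1/(4L), which beats the Lipschitz constant of the
drift; the remaining term is absorbed. The same contraction drives a Picard iteration with a
parameter θ, jointly measurable in θ and the randomness (`PathFamily.exists_isIntegralPath`). With θ
= ω and the uniform measure on indices it solves the particle system. With θ = β and the measure m
it yields a solution map, and inserting B and the input of the limit equation solves the conditional
equation, because independence identifies the conditional law.

The convergence concerns arbitrary solutions. For the limit equation, uniqueness
(`IsConditionalMcKeanVlasovSolution.ae_eq`) reduces to the constructed solution; for the particles,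
the stability estimate applies to every solution path by path.

One measurability issue remains: b is Borel for the Wasserstein topology, while laws depending on a
parameter are a priori measurable only through their values on sets. `measurable_comp_pMeasure`
bridges the two by quantization and continuity in the measure. -/

noncomputable section

/-- The `L^p` mean of a function with values in `[0,∞]`. -/
def lpMean {α : Type*} [MeasurableSpace α] (p : ℝ≥0) (m : Measure α) (f : α → ℝ≥0∞) : ℝ≥0∞ :=
  (∫⁻ a, f a ^ (p : ℝ) ∂m) ^ (1 / (p : ℝ))

/-! ### L^p means -/

section LpMean

variable {α β : Type*} [MeasurableSpace α] [MeasurableSpace β] {p : ℝ≥0} {m : Measure α}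

lemma lpMean_mono_ae {f g : α → ℝ≥0∞} (h : ∀ᵐ a ∂m, f a ≤ g a) :
    lpMean p m f ≤ lpMean p m g :=
  ENNReal.rpow_le_rpow (lintegral_mono_ae (h.mono fun _ ha => ENNReal.rpow_le_rpow ha p.coe_nonneg))
    (by positivity)

lemma lpMean_mono {f g : α → ℝ≥0∞} (h : ∀ a, f a ≤ g a) : lpMean p m f ≤ lpMean p m g :=
  lpMean_mono_ae (ae_of_all _ h)

lemma lpMean_add_le (hp : 1 ≤ p) {f g : α → ℝ≥0∞} (hf : AEMeasurable f m)
    (hg : AEMeasurable g m) :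
    lpMean p m (fun a => f a + g a) ≤ lpMean p m f + lpMean p m g :=
  ENNReal.lintegral_Lp_add_le hf hg (by exact_mod_cast hp)

lemma lpMean_const [IsProbabilityMeasure m] (hp : 1 ≤ p) (c : ℝ≥0∞) :
    lpMean p m (fun _ => c) = c := by
  have : (p : ℝ) ≠ 0 := by positivity
  simp [lpMean, ENNReal.rpow_rpow_inv this]

lemma lpMean_const_mul (hp : 1 ≤ p) (c : ℝ≥0∞) {f : α → ℝ≥0∞} (hf : AEMeasurable f m) :
    lpMean p m (fun a => c * f a) = c * lpMean p m f := by
  have : (p : ℝ) ≠ 0 := by positivity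
  simp only [lpMean, ENNReal.mul_rpow_of_nonneg _ _ p.coe_nonneg]
  rw [lintegral_const_mul'' _ (hf.pow_const _), ENNReal.mul_rpow_of_nonneg _ _ (by positivity),
    one_div, ENNReal.rpow_rpow_inv this]

lemma lpMean_map {f : β → ℝ≥0∞} (hf : Measurable f) {g : α → β} (hg : Measurable g) :
    lpMean p (m.map g) f = lpMean p m (fun a => f (g a)) := by
  rw [lpMean, lpMean, lintegral_map (hf.pow_const _) hg]

lemma lpMean_rpow (hp : 1 ≤ p) (f : α → ℝ≥0∞) :
    lpMean p m f ^ (p : ℝ) = ∫⁻ a, f a ^ (p : ℝ) ∂m := by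
  have : (p : ℝ) ≠ 0 := by positivity
  rw [lpMean, one_div, ENNReal.rpow_inv_rpow this]

lemma lpMean_lt_top_iff (hp : 1 ≤ p) {f : α → ℝ≥0∞} :
    lpMean p m f < ∞ ↔ ∫⁻ a, f a ^ (p : ℝ) ∂m < ∞ := by
  rw [lpMean, ENNReal.rpow_lt_top_iff_of_pos (by positivity)]

lemma memLp_iff_lpMean_lt_top {F : Type*} [NormedAddCommGroup F] (hp : 1 ≤ p) {f : α → F}
    (hf : AEStronglyMeasurable f m) : MemLp f p m ↔ lpMean p m (fun a => ‖f a‖ₑ) < ∞ := by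
  have h0 : p ≠ 0 := by positivity
  rw [MemLp, eLpNorm_nnreal_eq_lintegral h0]
  exact and_iff_right hf

end LpMean

/-! ### Couplings and Wasserstein distance -/

section Wasserstein

variable {α E : Type*} [MeasurableSpace α] {p : ℝ≥0}

section

variable [PseudoEMetricSpace E] [MeasurableSpace E]

lemma wasserstein_le_lpMean {μ ν : Measure E} {m : Measure (E × E)} (h₁ : m.map Prod.fst = μ)
    (h₂ : m.map Prod.snd = ν) : wasserstein p μ ν ≤ lpMean p m fun z => edist z.1 z.2 :=
  ENNReal.rpow_le_rpow (iInf₂_le m ⟨h₁, h₂⟩) (by positivity)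

lemma exists_coupling_of_wasserstein_lt (hp : 1 ≤ p) {μ ν : Measure E} {ε : ℝ≥0∞}
    (h : wasserstein p μ ν < ε) :
    ∃ m : Measure (E × E), m.map Prod.fst = μ ∧ m.map Prod.snd = ν ∧
      lpMean p m (fun z => edist z.1 z.2) < ε := by
  have hp0 : 0 < (p : ℝ) := by positivity
  rw [wasserstein, one_div, ENNReal.rpow_inv_lt_iff hp0] at h
  simp only [iInf_lt_iff] at h
  obtain ⟨m, hm, hlt⟩ := h
  refine ⟨m, hm.1, hm.2, ?_⟩
  rwa [lpMean, one_div, ENNReal.rpow_inv_lt_iff hp0]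

variable [OpensMeasurableSpace E] [SecondCountableTopology E]

lemma wasserstein_map_map_le {f g : α → E} (π : Measure α) (hf : Measurable f)
    (hg : Measurable g) :
    wasserstein p (π.map f) (π.map g) ≤ lpMean p π fun a => edist (f a) (g a) := by
  have h := wasserstein_le_lpMean (p := p) (m := π.map fun a => (f a, g a))
    (μ := π.map f) (ν := π.map g)
    (by rw [Measure.map_map measurable_fst (hf.prodMk hg)]; rfl)
    (by rw [Measure.map_map measurable_snd (hf.prodMk hg)]; rfl)
  rwa [lpMean_map (measurable_edist) (hf.prodMk hg)] at h

lemma wasserstein_map_le {f : E → E} (μ : Measure E) (hf : Measurable f) :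
    wasserstein p μ (μ.map f) ≤ lpMean p μ fun x => edist x (f x) := by
  simpa using wasserstein_map_map_le (p := p) μ measurable_id hf

lemma wasserstein_comm (μ ν : Measure E) : wasserstein p μ ν = wasserstein p ν μ := by
  have key : ∀ μ ν : Measure E, wasserstein p μ ν ≤ wasserstein p ν μ := by
    intro μ ν
    refine ENNReal.rpow_le_rpow (le_iInf₂ fun m hm => ?_) (by positivity)
    have h₁ : (m.map Prod.swap).map Prod.fst = μ := by
      rw [Measure.map_map measurable_fst measurable_swap]; exact hm.2
    have h₂ : (m.map Prod.swap).map Prod.snd = ν := by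
      rw [Measure.map_map measurable_snd measurable_swap]; exact hm.1
    refine (iInf₂_le (m.map Prod.swap) ⟨h₁, h₂⟩).trans ?_
    rw [lintegral_map (measurable_edist.pow_const _) measurable_swap]
    simp [edist_comm]
  exact le_antisymm (key _ _) (key _ _)

end

/-- Two measures with a common marginal can be glued along it. -/
lemma exists_gluing {α β γ : Type*} [MeasurableSpace α] [MeasurableSpace β] [MeasurableSpace γ]
    [StandardBorelSpace α] [Nonempty α] (π₁ : Measure (α × β)) (π₂ : Measure (β × γ))
    [IsFiniteMeasure π₁] [IsFiniteMeasure π₂] (h : π₁.map Prod.snd = π₂.map Prod.fst) :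
    ∃ π : Measure (α × β × γ), π.map (fun z => (z.1, z.2.1)) = π₁ ∧ π.map Prod.snd = π₂ := by
  set ρ : Measure (β × α) := π₁.map Prod.swap with hρ
  have hρfst : ρ.fst = π₂.map Prod.fst := by
    rw [Measure.fst, hρ, Measure.map_map measurable_fst measurable_swap, ← h]; rfl
  -- The first coordinate is drawn from its conditional law given the shared coordinate alone, so it
  -- is conditionally independent of the third.
  set k : Kernel (β × γ) α := ρ.condKernel.comap Prod.fst measurable_fst
  have hswap : Measurable fun z : (β × γ) × α => (z.2, z.1) := by fun_prop
  refine ⟨(π₂ ⊗ₘ k).map fun z => (z.2, z.1), ?_, ?_⟩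
  · have hπ₁ : π₁ = ρ.map Prod.swap := by
      rw [hρ, Measure.map_map measurable_swap measurable_swap]; simp
    rw [Measure.map_map (by fun_prop) hswap]
    refine Measure.ext_of_lintegral _ fun f hf => ?_
    rw [lintegral_map hf (by fun_prop)]
    change ∫⁻ a : (β × γ) × α, f (a.2, a.1.1) ∂(π₂ ⊗ₘ k) = _
    rw [Measure.lintegral_compProd
        (f := fun a : (β × γ) × α => f (a.2, a.1.1)) (hf.comp (by fun_prop))]
    conv_rhs => rw [hπ₁, lintegral_map hf measurable_swap, ← ρ.disintegrate ρ.condKernel,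
      Measure.lintegral_compProd (f := fun a : β × α => f a.swap) (hf.comp measurable_swap), hρfst]
    rw [lintegral_map _ measurable_fst]
    · rfl
    · exact (hf.comp measurable_swap).lintegral_kernel_prod_right'
  · rw [Measure.map_map measurable_snd hswap]
    exact Measure.fst_compProd π₂ k

lemma isProbabilityMeasure_of_map {α β : Type*} [MeasurableSpace α] [MeasurableSpace β]
    {m : Measure α} {f : α → β} {μ : Measure β} [IsProbabilityMeasure μ] (hf : Measurable f)
    (h : m.map f = μ) : IsProbabilityMeasure m := by
  constructor
  rw [← Set.preimage_univ (f := f), ← Measure.map_apply hf MeasurableSet.univ, h, measure_univ]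

/-- Gluing two almost optimal couplings along ν puts all three points on one space, where
Minkowski's inequality applies. The slack ε avoids the existence of optimal couplings. -/
lemma wasserstein_triangle [PseudoEMetricSpace E] [MeasurableSpace E] [OpensMeasurableSpace E]
    [SecondCountableTopology E] [StandardBorelSpace E] (hp : 1 ≤ p)
    (μ ν ρ : Measure E) [IsProbabilityMeasure ν] :
    wasserstein p μ ρ ≤ wasserstein p μ ν + wasserstein p ν ρ := by
  have : Nonempty E := by
    by_contra h
    rw [not_nonempty_iff] at h
    have := measure_univ (μ := ν)
    simp [Set.eq_empty_of_isEmpty] at this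
  refine ENNReal.le_of_forall_pos_le_add fun ε hε hfin => ?_
  have hε' : (ε / 2 : ℝ≥0∞) ≠ 0 := by simpa using hε.ne'
  obtain ⟨hμν, hνρ⟩ := ENNReal.add_lt_top.mp hfin
  obtain ⟨π₁, h₁, h₁', hlt₁⟩ :=
    exists_coupling_of_wasserstein_lt hp (ENNReal.lt_add_right hμν.ne hε')
  obtain ⟨π₂, h₂, h₂', hlt₂⟩ :=
    exists_coupling_of_wasserstein_lt hp (ENNReal.lt_add_right hνρ.ne hε')
  have := isProbabilityMeasure_of_map measurable_snd h₁'
  have := isProbabilityMeasure_of_map measurable_fst h₂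
  obtain ⟨π, hπ₁, hπ₂⟩ := exists_gluing π₁ π₂ (h₁'.trans h₂.symm)
  have e₁ : π.map Prod.fst = μ := by
    rw [← h₁, ← hπ₁, Measure.map_map measurable_fst (by fun_prop)]; rfl
  have e₂ : π.map (fun z => z.2.2) = ρ := by
    rw [← h₂', ← hπ₂, Measure.map_map measurable_snd measurable_snd]; rfl
  calc wasserstein p μ ρ ≤ lpMean p π (fun z => edist z.1 z.2.2) := by
        rw [← e₁, ← e₂]; exact wasserstein_map_map_le π measurable_fst (by fun_prop)
    _ ≤ lpMean p π (fun z => edist z.1 z.2.1 + edist z.2.1 z.2.2) :=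
        lpMean_mono fun z => edist_triangle _ _ _
    _ ≤ lpMean p π (fun z => edist z.1 z.2.1) + lpMean p π (fun z => edist z.2.1 z.2.2) :=
        lpMean_add_le hp (by fun_prop) (by fun_prop)
    _ = lpMean p π₁ (fun z => edist z.1 z.2) + lpMean p π₂ (fun z => edist z.1 z.2) := by
        rw [← hπ₁, ← hπ₂, lpMean_map measurable_edist (by fun_prop),
          lpMean_map measurable_edist (by fun_prop)]
    _ ≤ (wasserstein p μ ν + ε / 2) + (wasserstein p ν ρ + ε / 2) := add_le_add hlt₁.le hlt₂.le
    _ = wasserstein p μ ν + wasserstein p ν ρ + ε := by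
        rw [add_add_add_comm, ENNReal.add_halves]

/-- The common mass min(u, v) stays in place, and the excess of u is sent to the excess of v by
their product, normalised by the excess mass c. The crude right-hand side suffices: for fixed atoms
it tends to zero as the weights converge. -/
lemma wasserstein_sum_dirac_le [PseudoEMetricSpace E] [MeasurableSpace E]
    [OpensMeasurableSpace E] [SecondCountableTopology E] {J : Type*} [Fintype J]
    (hp : 1 ≤ p) (x : J → E) (u v : J → ℝ≥0∞)
    (hu : ∑ j, u j = 1) (hv : ∑ j, v j = 1) :
    wasserstein p (∑ j, u j • Measure.dirac (x j)) (∑ j, v j • Measure.dirac (x j)) ^ (p : ℝ) ≤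
      (∑ j, (u j - v j)) * ∑ j, ∑ k, edist (x j) (x k) ^ (p : ℝ) := by
  have hp0 : 0 < (p : ℝ) := by positivity
  set c := ∑ j, (u j - v j) with hc
  have hmin : ∑ j, min (u j) (v j) ≠ ∞ :=
    ne_top_of_le_ne_top ENNReal.one_ne_top (hu ▸ Finset.sum_le_sum fun j _ => min_le_left _ _)
  -- Subtraction is truncated, so this is the excess of v over u; both excesses complete the common
  -- mass to 1.
  have hc' : ∑ j, (v j - u j) = c := by
    have h1 : c + ∑ j, min (u j) (v j) = 1 := by
      rw [hc, ← Finset.sum_add_distrib, ← hu]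
      exact Finset.sum_congr rfl fun j _ => tsub_add_min
    have h2 : (∑ j, (v j - u j)) + ∑ j, min (u j) (v j) = 1 := by
      rw [← Finset.sum_add_distrib, ← hv]
      exact Finset.sum_congr rfl fun j _ => by rw [min_comm]; exact tsub_add_min
    exact (ENNReal.add_left_inj hmin).mp (h2.trans h1.symm)
  have hctop : c ≠ ∞ :=
    ne_top_of_le_ne_top ENNReal.one_ne_top (hu ▸ Finset.sum_le_sum fun j _ => tsub_le_self)
  -- When c = 0 the inverse is ∞, but then a = 0 and both sides vanish.
  have hcancel : ∀ a ≤ c, c⁻¹ * (a * c) = a := by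
    intro a ha
    rcases eq_or_ne c 0 with h0 | h0
    · have : a = 0 := by simpa [h0] using ha
      simp [this]
    · rw [mul_left_comm, ENNReal.inv_mul_cancel h0 hctop, mul_one]
  have hule : ∀ j, u j - v j ≤ c := fun j =>
    Finset.single_le_sum (f := fun j => u j - v j) (fun _ _ => zero_le) (Finset.mem_univ j)
  have hvle : ∀ j, v j - u j ≤ c := fun j => hc' ▸
    Finset.single_le_sum (f := fun j => v j - u j) (fun _ _ => zero_le) (Finset.mem_univ j)
  set m : Measure (E × E) := (∑ j, min (u j) (v j) • Measure.dirac (x j, x j)) +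
    ∑ j, ∑ k, (c⁻¹ * ((u j - v j) * (v k - u k))) • Measure.dirac (x j, x k) with hm
  have hm₁ : m.map Prod.fst = ∑ j, u j • Measure.dirac (x j) := by
    rw [hm, Measure.map_add _ _ measurable_fst, Measure.map_finset_sum measurable_fst.aemeasurable,
      Measure.map_finset_sum measurable_fst.aemeasurable, ← Finset.sum_add_distrib]
    refine Finset.sum_congr rfl fun j _ => ?_
    rw [Measure.map_finset_sum measurable_fst.aemeasurable]
    simp only [Measure.map_smul, Measure.map_dirac' measurable_fst]
    rw [← Finset.sum_smul, ← add_smul, ← Finset.mul_sum, ← Finset.mul_sum, hc', hcancel _ (hule j),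
      add_comm, tsub_add_min]
  have hm₂ : m.map Prod.snd = ∑ j, v j • Measure.dirac (x j) := by
    rw [hm, Measure.map_add _ _ measurable_snd, Finset.sum_comm,
      Measure.map_finset_sum measurable_snd.aemeasurable,
      Measure.map_finset_sum measurable_snd.aemeasurable, ← Finset.sum_add_distrib]
    refine Finset.sum_congr rfl fun j _ => ?_
    rw [Measure.map_finset_sum measurable_snd.aemeasurable]
    simp only [Measure.map_smul, Measure.map_dirac' measurable_snd]
    simp only [mul_comm (u _ - v _)]
    rw [← Finset.sum_smul, ← add_smul, ← Finset.mul_sum, ← Finset.mul_sum, ← hc, hcancel _ (hvle j),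
      add_comm, min_comm, tsub_add_min]
  refine (ENNReal.rpow_le_rpow (wasserstein_le_lpMean hm₁ hm₂) p.coe_nonneg).trans ?_
  have hd : Measurable fun z : E × E => edist z.1 z.2 ^ (p : ℝ) := measurable_edist.pow_const _
  have h₀ : ∀ j, ∫⁻ z : E × E, edist z.1 z.2 ^ (p : ℝ) ∂Measure.dirac (x j, x j) = 0 := fun j => by
    rw [lintegral_dirac' _ hd]; simp [hp0]
  rw [lpMean_rpow hp, hm, lintegral_add_measure, lintegral_finsetSum_measure,
    lintegral_finsetSum_measure]
  simp only [lintegral_finsetSum_measure, lintegral_smul_measure, h₀, smul_zero,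
    Finset.sum_const_zero, zero_add]
  simp only [lintegral_dirac' _ hd, smul_eq_mul]
  rw [Finset.mul_sum]
  refine Finset.sum_le_sum fun j _ => ?_
  rw [Finset.mul_sum]
  refine Finset.sum_le_sum fun k _ => ?_
  gcongr
  calc c⁻¹ * ((u j - v j) * (v k - u k)) ≤ c⁻¹ * ((u j - v j) * c) := by
        gcongr; exact hvle k
    _ = u j - v j := hcancel _ (hule j)
    _ ≤ c := hule j

end Wasserstein

lemma lpMean_enorm {α F : Type*} [MeasurableSpace α] {m : Measure α} [NormedAddCommGroup F]
    {p : ℝ≥0} (hp : 1 ≤ p) (f : α → F) : lpMean p m (fun a => ‖f a‖ₑ) = eLpNorm f p m :=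
  (eLpNorm_nnreal_eq_lintegral (by positivity)).symm

/-! ### Measurability of maps into the Wasserstein space -/

namespace PMeasure

variable {E : Type*} [NormedAddCommGroup E] [MeasurableSpace E] {p : ℝ≥0}

attribute [instance] PMeasure.isProbabilityMeasure

lemma ext_toMeasure {μ ν : PMeasure p E} (h : μ.toMeasure = ν.toMeasure) : μ = ν := by
  cases μ; cases ν; congr

/-- The law of a random variable with finite `p`-th moment. -/
@[simps]
def ofMap {α : Type*} [MeasurableSpace α] [OpensMeasurableSpace E] (hp : 1 ≤ p) (m : Measure α)
    [IsProbabilityMeasure m] (f : α → E) (hf : Measurable f)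
    (h : lpMean p m (fun a => ‖f a‖ₑ) < ∞) : PMeasure p E where
  toMeasure := m.map f
  isProbabilityMeasure := Measure.isProbabilityMeasure_map hf.aemeasurable
  moment_lt_top := by
    rwa [lintegral_map (by fun_prop) hf, ← lpMean_lt_top_iff hp]

lemma lpMean_enorm_lt_top (hp : 1 ≤ p) (μ : PMeasure p E) :
    lpMean p μ.toMeasure (fun x => ‖x‖ₑ) < ∞ :=
  (lpMean_lt_top_iff hp).mpr μ.moment_lt_top

lemma continuous_of_tendsto_wasserstein {S : Type*} [TopologicalSpace S] {φ : S → PMeasure p E}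
    (h : ∀ a, Tendsto (fun b => wasserstein p (φ a).toMeasure (φ b).toMeasure) (𝓝 a) (𝓝 0)) :
    Continuous φ := by
  refine continuous_def.mpr fun U hU => isOpen_iff_mem_nhds.mpr fun a ha => ?_
  obtain ⟨ε, hε, hεU⟩ := hU (φ a) ha
  filter_upwards [(h a).eventually_lt_const hε] with b hb using hεU _ hb

/-- With the atoms fixed, the measure is a Wasserstein-continuous function of its weights on the
simplex, so measurable weights give a measurable map for the Wasserstein Borel σ-algebra. -/
lemma measurable_of_sum_dirac [OpensMeasurableSpace E] [SecondCountableTopology E]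
    {A J : Type*} [MeasurableSpace A] [Fintype J] (hp : 1 ≤ p) (x : J → E) {w : A → J → ℝ≥0∞}
    (hw : Measurable w) {ν : A → PMeasure p E}
    (hν : ∀ a, (ν a).toMeasure = ∑ j, w a j • Measure.dirac (x j)) : Measurable ν := by
  have hp0 : 0 < (p : ℝ) := by positivity
  have hmass : ∀ a, ∑ j, w a j = 1 := fun a => by
    have := measure_univ (μ := (ν a).toMeasure)
    rw [hν] at this
    simpa using this
  let S := {w : J → ℝ≥0∞ // ∑ j, w j = 1}
  have hS : ∀ u : S, ∀ j, u.1 j ≠ ∞ := fun u j =>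
    ne_top_of_le_ne_top (u.2.trans_ne ENNReal.one_ne_top)
      (Finset.single_le_sum (f := u.1) (fun _ _ => zero_le) (Finset.mem_univ j))
  let φ : S → PMeasure p E := fun u =>
    { toMeasure := ∑ j, u.1 j • Measure.dirac (x j)
      isProbabilityMeasure := ⟨by simpa using u.2⟩
      moment_lt_top := by
        rw [lintegral_finsetSum_measure]
        refine ENNReal.sum_lt_top.mpr fun j _ => ?_
        rw [lintegral_smul_measure, lintegral_dirac' _ (by fun_prop)]
        exact ENNReal.mul_lt_top (hS u j).lt_top
          (ENNReal.rpow_lt_top_of_nonneg p.coe_nonneg enorm_ne_top) }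
  have hφ : Continuous φ := by
    refine continuous_of_tendsto_wasserstein fun u => ?_
    set D := ∑ j, ∑ k, edist (x j) (x k) ^ (p : ℝ) with hD
    have hDtop : D ≠ ∞ := by
      refine (ENNReal.sum_lt_top.mpr fun j _ => ENNReal.sum_lt_top.mpr fun k _ => ?_).ne
      exact ENNReal.rpow_lt_top_of_nonneg p.coe_nonneg (edist_ne_top _ _)
    have hlim : Tendsto (fun v : S => ((∑ j, (u.1 j - v.1 j)) * D) ^ (p : ℝ)⁻¹) (𝓝 u) (𝓝 0) := by
      have h1 : Tendsto (fun v : S => ∑ j, (u.1 j - v.1 j)) (𝓝 u) (𝓝 (∑ j, (u.1 j - u.1 j))) := by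
        refine tendsto_finsetSum _ fun j _ => ?_
        refine ENNReal.Tendsto.sub tendsto_const_nhds ?_ (Or.inl (hS u j))
        exact ((continuous_apply j).comp continuous_subtype_val).tendsto u
      simp only [tsub_self, Finset.sum_const_zero] at h1
      have h2 := (ENNReal.Tendsto.mul_const h1 (Or.inr hDtop)).ennrpow_const (p : ℝ)⁻¹
      simpa [hp0] using h2
    refine tendsto_of_tendsto_of_tendsto_of_le_of_le tendsto_const_nhds hlim
      (fun _ => zero_le) fun v => ?_
    have := ENNReal.rpow_le_rpow (z := (p : ℝ)⁻¹) (wasserstein_sum_dirac_le hp x u.1 v.1 u.2 v.2)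
      (by positivity)
    rwa [ENNReal.rpow_rpow_inv hp0.ne'] at this
  have : ν = φ ∘ fun a => ⟨w a, hmass a⟩ := funext fun a => ext_toMeasure (hν a)
  rw [this]
  exact hφ.measurable.comp (hw.subtype_mk)

end PMeasure

/-! ### Approximation by finitely supported measures -/

section Quantizer

variable (E : Type*) [NormedAddCommGroup E] [MeasurableSpace E] [BorelSpace E]
  [SecondCountableTopology E]

/-- Simple functions approximating the identity. -/
def quantizer (n : ℕ) : SimpleFunc E E :=
  SimpleFunc.approxOn id measurable_id Set.univ 0 trivial n

variable {E} {p : ℝ≥0}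

lemma tendsto_lpMean_quantizer (hp : 1 ≤ p) {μ : Measure E}
    (hμ : lpMean p μ (fun x => ‖x‖ₑ) < ∞) :
    Tendsto (fun n => lpMean p μ fun x => edist x (quantizer E n x)) atTop (𝓝 0) := by
  have h := SimpleFunc.tendsto_approxOn_Lp_eLpNorm (p := p) (μ := μ) (f := (id : E → E))
    measurable_id (s := Set.univ) (y₀ := 0) trivial ENNReal.coe_ne_top (by simp)
    (by simpa [← lpMean_enorm hp] using hμ)
  refine h.congr fun n => ?_
  rw [← lpMean_enorm hp]
  simp [quantizer, edist_eq_enorm_sub, enorm_sub_rev]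

lemma map_simpleFunc_eq_sum {α β : Type*} [MeasurableSpace α]
    [MeasurableSpace β] (q : SimpleFunc α β) (hq : Measurable q) (μ : Measure α) :
    μ.map q = ∑ y : q.range, μ (q ⁻¹' {(y : β)}) • Measure.dirac (y : β) := by
  refine Measure.ext_of_lintegral _ fun f hf => ?_
  rw [lintegral_map hf hq, lintegral_finsetSum_measure]
  simp only [lintegral_smul_measure, lintegral_dirac' _ hf, smul_eq_mul]
  rw [← Finset.sum_coe_sort q.range (fun y => μ (q ⁻¹' {y}) * f y) |>.symm]
  have := (q.map f).lintegral_eq_lintegral μ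
  rw [SimpleFunc.map_lintegral] at this
  simp only [SimpleFunc.coe_map, Function.comp_apply] at this
  rw [this]
  exact Finset.sum_congr rfl fun _ _ => mul_comm _ _

lemma lpMean_quantizer_lt_top (hp : 1 ≤ p) {μ : Measure E} [IsFiniteMeasure μ] (n : ℕ) :
    lpMean p μ (fun x => ‖quantizer E n x‖ₑ) < ∞ := by
  rw [lpMean_enorm hp]
  exact (SimpleFunc.memLp_of_isFiniteMeasure _ _ _).2

end Quantizer

/-- A measurable function of a point and a measure, continuous in the measure for the Wasserstein
distance, may be composed with a random measure that is merely weakly measurable. -/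
lemma measurable_comp_pMeasure {E F A S : Type*} [NormedAddCommGroup E] [MeasurableSpace E]
    [BorelSpace E] [SecondCountableTopology E] [TopologicalSpace F]
    [TopologicalSpace.PseudoMetrizableSpace F] [MeasurableSpace F] [BorelSpace F]
    [MeasurableSpace A] [MeasurableSpace S] {p : ℝ≥0} (hp : 1 ≤ p) {g : S → PMeasure p E → F}
    (hg : Measurable fun z : S × PMeasure p E => g z.1 z.2)
    (hcont : ∀ s (μ : PMeasure p E) (ν : ℕ → PMeasure p E),
      Tendsto (fun n => wasserstein p μ.toMeasure (ν n).toMeasure) atTop (𝓝 0) →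
      Tendsto (fun n => g s (ν n)) atTop (𝓝 (g s μ)))
    {y : A → S} (hy : Measurable y) {ν : A → PMeasure p E}
    (hν : Measurable fun a => (ν a).toMeasure) : Measurable fun a => g (y a) (ν a) := by
  have hq : ∀ n, Measurable (quantizer E n) := fun n => (quantizer E n).measurable
  -- Quantized measures have fixed finite support and measurable weights, hence are measurable into
  -- the Wasserstein space; continuity in the measure then passes to the limit.
  let ν' : ℕ → A → PMeasure p E := fun n a => PMeasure.ofMap hp (ν a).toMeasure (quantizer E n)
    (hq n) (lpMean_quantizer_lt_top hp n)
  refine measurable_of_tendsto_metrizable (f := fun n a => g (y a) (ν' n a)) (fun n => ?_)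
    (tendsto_pi_nhds.mpr fun a => hcont _ _ _ ?_)
  · refine hg.comp (hy.prodMk ?_)
    refine PMeasure.measurable_of_sum_dirac hp (J := (quantizer E n).range) (fun j => j.1)
      (w := fun a j => (ν a).toMeasure (quantizer E n ⁻¹' {j.1})) ?_ fun a => ?_
    · exact measurable_pi_lambda _ fun j =>
        (Measure.measurable_coe ((quantizer E n).measurableSet_fiber j.1)).comp hν
    · exact map_simpleFunc_eq_sum _ (hq n) _
  · exact tendsto_of_tendsto_of_tendsto_of_le_of_le tendsto_const_nhds
      (tendsto_lpMean_quantizer hp ((ν a).lpMean_enorm_lt_top hp)) (fun _ => zero_le)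
      fun n => wasserstein_map_le _ (hq n)

/-! ### Path space, exponential weights and integral equations -/

section Paths

variable {d : ℕ} {T : ℝ}

/-- A map into path space is measurable as soon as its evaluations are. -/
lemma measurable_pathSpace {A : Type*} [MeasurableSpace A] {X : A → PathSpace d T}
    (h : ∀ t, Measurable fun a => X a t) : Measurable X := by
  obtain ⟨D, hDc, hD⟩ := TopologicalSpace.exists_countable_dense (Set.Icc (0 : ℝ) T)
  have := hDc.to_subtype
  let ι : PathSpace d T → (D → EuclideanSpace ℝ (Fin d)) := fun x t => x t
  have hι : Continuous ι := continuous_pi fun t => continuous_eval_const _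
  have hinj : Function.Injective ι := fun x y hxy => DFunLike.coe_injective <|
    Continuous.ext_on hD x.continuous y.continuous fun t ht => congrFun hxy ⟨t, ht⟩
  rw [← (hι.measurableEmbedding hinj).measurable_comp_iff]
  exact measurable_pi_lambda _ fun t => h t

instance isFiniteMeasure_timeMeasure : IsFiniteMeasure (timeMeasure T) := by
  constructor
  rw [timeMeasure, (MeasurableEmbedding.subtype_coe measurableSet_Icc).comap_apply,
    Set.image_univ, Subtype.range_coe, Real.volume_Icc]
  exact ENNReal.ofReal_lt_top

lemma timeMeasure_singleton (t : Set.Icc (0 : ℝ) T) : timeMeasure T {t} = 0 := by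
  rw [timeMeasure, (MeasurableEmbedding.subtype_coe measurableSet_Icc).comap_apply]
  simp

/-- Enlarging the domain to the half-line (-∞, t] makes the integral exactly e^{lt}/l. The factor
1/l is the source of every contraction below. -/
lemma setLIntegral_exp_le {l : ℝ} (hl : 0 < l) (t : Set.Icc (0 : ℝ) T) :
    ∫⁻ s in Set.Iic t, ENNReal.ofReal (Real.exp (l * s)) ∂timeMeasure T ≤
      ENNReal.ofReal (Real.exp (l * t)) / ENNReal.ofReal l := by
  have he := MeasurableEmbedding.subtype_coe (measurableSet_Icc (a := (0 : ℝ)) (b := T))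
  have h1 : ∫⁻ s in Set.Iic t, ENNReal.ofReal (Real.exp (l * s)) ∂timeMeasure T =
      ∫⁻ s in Set.Iic (t : ℝ), ENNReal.ofReal (Real.exp (l * s))
        ∂((timeMeasure T).map Subtype.val) := by
    rw [← lintegral_indicator measurableSet_Iic, ← lintegral_indicator measurableSet_Iic,
      he.lintegral_map]
    rfl
  rw [h1, timeMeasure, he.map_comap]
  calc _ ≤ ∫⁻ s in Set.Iic (t : ℝ), ENNReal.ofReal (Real.exp (l * s)) :=
        lintegral_mono' (Measure.restrict_mono le_rfl Measure.restrict_le_self) le_rfl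
    _ = ENNReal.ofReal (∫ s in Set.Iic (t : ℝ), Real.exp (l * s)) :=
        (ofReal_integral_eq_lintegral_ofReal (integrableOn_exp_mul_Iic hl _)
          (ae_of_all _ fun s => (Real.exp_pos _).le)).symm
    _ = _ := by rw [integral_exp_mul_Iic hl, ENNReal.ofReal_div_of_pos hl]

/-- The distance of paths with exponential weight `e^{-lt}`. -/
def weightedDist (l : ℝ) (x y : PathSpace d T) : ℝ≥0∞ :=
  ⨆ t : Set.Icc (0 : ℝ) T, ENNReal.ofReal (Real.exp (-(l * t))) * edist (x t) (y t)

lemma ofReal_exp_mul_ofReal_exp_neg (a : ℝ) :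
    ENNReal.ofReal (Real.exp a) * ENNReal.ofReal (Real.exp (-a)) = 1 := by
  rw [← ENNReal.ofReal_mul (Real.exp_pos a).le, ← Real.exp_add]; simp

lemma edist_apply_le_weightedDist (l : ℝ) (x y : PathSpace d T) (t : Set.Icc (0 : ℝ) T) :
    edist (x t) (y t) ≤ ENNReal.ofReal (Real.exp (l * t)) * weightedDist l x y := by
  calc edist (x t) (y t) = ENNReal.ofReal (Real.exp (l * t)) *
        (ENNReal.ofReal (Real.exp (-(l * t))) * edist (x t) (y t)) := by
        rw [← mul_assoc, ofReal_exp_mul_ofReal_exp_neg, one_mul]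
    _ ≤ _ := by
        gcongr
        exact le_iSup (fun t : Set.Icc (0 : ℝ) T =>
          ENNReal.ofReal (Real.exp (-(l * t))) * edist (x t) (y t)) t

lemma weightedDist_le {l : ℝ} {x y : PathSpace d T} {a : ℝ≥0∞}
    (h : ∀ t : Set.Icc (0 : ℝ) T, edist (x t) (y t) ≤ ENNReal.ofReal (Real.exp (l * t)) * a) :
    weightedDist l x y ≤ a := by
  refine iSup_le fun t => ?_
  calc _ ≤ ENNReal.ofReal (Real.exp (-(l * t))) * (ENNReal.ofReal (Real.exp (l * t)) * a) := by
        gcongr; exact h t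
    _ = a := by
        rw [← mul_assoc, mul_comm (ENNReal.ofReal _), ofReal_exp_mul_ofReal_exp_neg, one_mul]

lemma edist_apply_le (x y : PathSpace d T) (t : Set.Icc (0 : ℝ) T) :
    edist (x t) (y t) ≤ edist x y := by
  rw [ContinuousMap.edist_eq_iSup]; exact le_iSup (fun t => edist (x t) (y t)) t

lemma one_le_ofReal_exp {l : ℝ} (hl : 0 ≤ l) (t : Set.Icc (0 : ℝ) T) :
    1 ≤ ENNReal.ofReal (Real.exp (l * t)) := by
  rw [ENNReal.one_le_ofReal]
  exact Real.one_le_exp (mul_nonneg hl t.2.1)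

lemma weightedDist_le_edist {l : ℝ} (hl : 0 ≤ l) (x y : PathSpace d T) :
    weightedDist l x y ≤ edist x y :=
  weightedDist_le fun t => (edist_apply_le x y t).trans
    (le_mul_of_one_le_left zero_le (one_le_ofReal_exp hl t))

lemma edist_le_weightedDist {l : ℝ} (hl : 0 ≤ l) (x y : PathSpace d T) :
    edist x y ≤ ENNReal.ofReal (Real.exp (l * T)) * weightedDist l x y := by
  rw [ContinuousMap.edist_eq_iSup]
  refine iSup_le fun t => (edist_apply_le_weightedDist l x y t).trans ?_
  gcongr
  exact t.2.2

/-- The supremum runs over uncountably many times, but of continuous functions, so it is lower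
semicontinuous. -/
lemma measurable_weightedDist (l : ℝ) :
    Measurable fun z : PathSpace d T × PathSpace d T => weightedDist l z.1 z.2 := by
  refine LowerSemicontinuous.measurable (lowerSemicontinuous_iSup fun t => ?_)
  refine Continuous.lowerSemicontinuous ?_
  refine ENNReal.continuous_const_mul ENNReal.ofReal_ne_top |>.comp ?_
  exact ((continuous_eval_const t).comp continuous_fst).edist
    ((continuous_eval_const t).comp continuous_snd)

lemma measurable_weightedDist_comp {A : Type*} [MeasurableSpace A] {l : ℝ} {x y : A → PathSpace d T}
    (hx : Measurable x) (hy : Measurable y) : Measurable fun a => weightedDist l (x a) (y a) := by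
  have h := measurable_weightedDist (d := d) (T := T) l
  fun_prop

variable {f g : Set.Icc (0 : ℝ) T → EuclideanSpace ℝ (Fin d)}

/-- The indicator of {s ≤ u} is continuous in u at t except when s = t, a null event since time has
no atoms; dominated convergence does the rest. -/
lemma continuous_setIntegral_Iic (hf : Integrable f (timeMeasure T)) :
    Continuous fun t => ∫ s in Set.Iic t, f s ∂timeMeasure T := by
  simp_rw [← integral_indicator (measurableSet_Iic)]
  refine continuous_iff_continuousAt.mpr fun t => ?_
  refine continuousAt_of_dominated (bound := fun s => ‖f s‖)
    (Eventually.of_forall fun u => hf.1.indicator measurableSet_Iic)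
    (Eventually.of_forall fun u => ae_of_all _ fun s => norm_indicator_le_norm_self _ _)
    hf.norm ?_
  have hne : ∀ᵐ s ∂timeMeasure T, s ≠ t := measure_eq_zero_iff_ae_notMem.mp
    (timeMeasure_singleton t)
  filter_upwards [hne] with s hs
  rcases lt_or_gt_of_ne hs with h | h
  · refine (continuousAt_const (y := f s)).congr ?_
    filter_upwards [lt_mem_nhds h] with u hu
    simp [hu.le]
  · refine (continuousAt_const (y := 0)).congr ?_
    filter_upwards [gt_mem_nhds h] with u hu
    simp [hu]

/-- The primitive of an integrable function, as a path. -/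
def primitivePath (f : Set.Icc (0 : ℝ) T → EuclideanSpace ℝ (Fin d))
    (hf : Integrable f (timeMeasure T)) : PathSpace d T :=
  ⟨fun t => ∫ s in Set.Iic t, f s ∂timeMeasure T, continuous_setIntegral_Iic hf⟩

lemma edist_setIntegral_Iic_le {l : ℝ} (hl : 0 < l) (hf : Integrable f (timeMeasure T))
    (hg : Integrable g (timeMeasure T)) {c : ℝ≥0∞}
    (h : ∀ s : Set.Icc (0 : ℝ) T, edist (f s) (g s) ≤ ENNReal.ofReal (Real.exp (l * s)) * c)
    (t : Set.Icc (0 : ℝ) T) :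
    edist (∫ s in Set.Iic t, f s ∂timeMeasure T) (∫ s in Set.Iic t, g s ∂timeMeasure T) ≤
      ENNReal.ofReal (Real.exp (l * t)) * (c / ENNReal.ofReal l) := by
  rw [edist_eq_enorm_sub, ← integral_sub hf.integrableOn hg.integrableOn]
  calc _ ≤ ∫⁻ s in Set.Iic t, ‖f s - g s‖ₑ ∂timeMeasure T := enorm_integral_le_lintegral_enorm _
    _ ≤ ∫⁻ s in Set.Iic t, ENNReal.ofReal (Real.exp (l * s)) * c ∂timeMeasure T := by
        refine lintegral_mono fun s => ?_
        rw [← edist_eq_enorm_sub]; exact h s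
    _ = (∫⁻ s in Set.Iic t, ENNReal.ofReal (Real.exp (l * s)) ∂timeMeasure T) * c :=
        lintegral_mul_const _ (by fun_prop)
    _ ≤ (ENNReal.ofReal (Real.exp (l * t)) / ENNReal.ofReal l) * c := by
        gcongr; exact setLIntegral_exp_le hl t
    _ = _ := by simp only [div_eq_mul_inv]; ring

/-- The path `x` is the sum of the path `z` and of the primitive of `f`. -/
def IsIntegralPath (z : PathSpace d T) (f : Set.Icc (0 : ℝ) T → EuclideanSpace ℝ (Fin d))
    (x : PathSpace d T) : Prop :=
  Integrable f (timeMeasure T) ∧ ∀ t, x t = z t + ∫ s in Set.Iic t, f s ∂timeMeasure T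

lemma solvesIntegralEq_iff {x₀ : EuclideanSpace ℝ (Fin d)} {w β x : PathSpace d T} :
    SolvesIntegralEq x₀ f w β x ↔ IsIntegralPath (ContinuousMap.const _ x₀ + w + β) f x := by
  refine and_congr_right fun _ => forall_congr' fun t => ?_
  simp only [ContinuousMap.add_apply, ContinuousMap.const_apply]
  rw [show x₀ + (∫ s in Set.Iic t, f s ∂timeMeasure T) + w t + β t =
    x₀ + w t + β t + ∫ s in Set.Iic t, f s ∂timeMeasure T by abel]

lemma isIntegralPath_add_primitivePath (z : PathSpace d T) (hf : Integrable f (timeMeasure T)) :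
    IsIntegralPath z f (z + primitivePath f hf) := ⟨hf, fun _ => rfl⟩

lemma IsIntegralPath.weightedDist_le {z z' x x' : PathSpace d T} {l : ℝ} (hl : 0 < l)
    (hx : IsIntegralPath z f x) (hx' : IsIntegralPath z' g x') {c : ℝ≥0∞}
    (h : ∀ s : Set.Icc (0 : ℝ) T, edist (f s) (g s) ≤ ENNReal.ofReal (Real.exp (l * s)) * c) :
    weightedDist l x x' ≤ edist z z' + c / ENNReal.ofReal l := by
  refine _root_.weightedDist_le fun t => ?_
  rw [hx.2 t, hx'.2 t, mul_add]
  refine (edist_add_add_le _ _ _ _).trans (add_le_add ?_ ?_)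
  · exact (edist_apply_le z z' t).trans
      (le_mul_of_one_le_left zero_le (one_le_ofReal_exp hl.le t))
  · exact edist_setIntegral_Iic_le hl hx.1 hx'.1 h t

end Paths

/-! ### Time marginals of path laws -/

section Marginals

variable {d : ℕ} {T : ℝ} {p : ℝ≥0}

/-- A coupling of the path laws, evaluated at s, couples the marginals at s. -/
lemma wasserstein_marginal_le {α : Type*} [MeasurableSpace α] {l : ℝ} (hp : 1 ≤ p)
    {π : Measure α} {x y : α → PathSpace d T} (hx : Measurable x) (hy : Measurable y)
    {μ ν : PMeasure p (PathSpace d T)} (hμ : π.map x = μ.toMeasure) (hν : π.map y = ν.toMeasure)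
    (s : Set.Icc (0 : ℝ) T) :
    wasserstein p (μ.marginal s).toMeasure (ν.marginal s).toMeasure ≤
      ENNReal.ofReal (Real.exp (l * s)) * lpMean p π fun a => weightedDist l (x a) (y a) := by
  have hev : Measurable fun γ : PathSpace d T => γ s := (continuous_eval_const s).measurable
  change wasserstein p (μ.toMeasure.map fun γ => γ s) (ν.toMeasure.map fun γ => γ s) ≤ _
  rw [← hμ, ← hν, Measure.map_map hev hx, Measure.map_map hev hy]
  refine (wasserstein_map_map_le π (hev.comp hx) (hev.comp hy)).trans ?_
  rw [← lpMean_const_mul hp _ (measurable_weightedDist_comp hx hy).aemeasurable]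
  exact lpMean_mono fun a => edist_apply_le_weightedDist l _ _ s

lemma lpMean_marginal_le (μ : PMeasure p (PathSpace d T)) (s : Set.Icc (0 : ℝ) T) :
    lpMean p (μ.marginal s).toMeasure (fun x => ‖x‖ₑ) ≤ lpMean p μ.toMeasure fun x => ‖x‖ₑ := by
  change lpMean p (μ.toMeasure.map fun γ => γ s) _ ≤ _
  rw [lpMean_map (by fun_prop) (continuous_eval_const s).measurable]
  refine lpMean_mono fun γ => ?_
  simpa using edist_apply_le γ 0 s

/-- The product coupling already gives this; it serves to bound distances to a reference measure by
moments. -/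
lemma wasserstein_le_lpMean_add_lpMean {E : Type*} [NormedAddCommGroup E] [MeasurableSpace E]
    [BorelSpace E] [SecondCountableTopology E] (hp : 1 ≤ p) (μ ν : Measure E)
    [IsProbabilityMeasure μ] [IsProbabilityMeasure ν] :
    wasserstein p μ ν ≤ lpMean p μ (fun x => ‖x‖ₑ) + lpMean p ν fun x => ‖x‖ₑ := by
  have h₁ : (μ.prod ν).map Prod.fst = μ := by simp
  have h₂ : (μ.prod ν).map Prod.snd = ν := by simp
  calc wasserstein p μ ν ≤ lpMean p (μ.prod ν) fun z => edist z.1 z.2 :=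
        wasserstein_le_lpMean h₁ h₂
    _ ≤ lpMean p (μ.prod ν) fun z => ‖z.1‖ₑ + ‖z.2‖ₑ := lpMean_mono fun z => by
        rw [edist_eq_enorm_sub]; exact enorm_sub_le
    _ ≤ lpMean p (μ.prod ν) (fun z => ‖z.1‖ₑ) + lpMean p (μ.prod ν) fun z => ‖z.2‖ₑ :=
        lpMean_add_le hp (by fun_prop) (by fun_prop)
    _ = _ := by
        rw [← lpMean_map (f := fun x => ‖x‖ₑ) (by fun_prop) measurable_fst,
          ← lpMean_map (f := fun x => ‖x‖ₑ) (by fun_prop) measurable_snd, h₁, h₂]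

end Marginals

/-! ### Lipschitz drifts and stability of the mean field equation -/

section MeanField

variable {d : ℕ} {T : ℝ} {p : ℝ≥0}

/-- A jointly measurable drift, integrable in time and uniformly Lipschitz in space and measure,
in the additive form of the Lipschitz condition. -/
structure LipschitzDrift (L : ℝ≥0) (b : Set.Icc (0 : ℝ) T → EuclideanSpace ℝ (Fin d) →
    PMeasure p (EuclideanSpace ℝ (Fin d)) → EuclideanSpace ℝ (Fin d)) : Prop where
  measurable : Measurable fun z : Set.Icc (0 : ℝ) T × EuclideanSpace ℝ (Fin d) ×
    PMeasure p (EuclideanSpace ℝ (Fin d)) => b z.1 z.2.1 z.2.2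
  one_le : 1 ≤ L
  edist_le : ∀ t x x' μ μ', edist (b t x μ) (b t x' μ') ≤
    L * (edist x x' + wasserstein p μ.toMeasure μ'.toMeasure)
  integrable_const : ∃ x μ, Integrable (fun t => b t x μ) (timeMeasure T)

variable {b : Set.Icc (0 : ℝ) T → EuclideanSpace ℝ (Fin d) →
    PMeasure p (EuclideanSpace ℝ (Fin d)) → EuclideanSpace ℝ (Fin d)} {L : ℝ≥0}

/-- Since p ≥ 1, a^p + c^p ≤ (a + c)^p. The constant K + 1 is at least 1, so that K ≤ K + 1 ≤ (K +
1)^p without distinguishing small K. -/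
lemma DriftAssumption.exists_lipschitzDrift (hp : 1 ≤ p) (hb : DriftAssumption b)
    (hb_int : ∃ x μ, Integrable (fun t => b t x μ) (timeMeasure T)) :
    ∃ L, LipschitzDrift L b := by
  obtain ⟨K, hK⟩ := hb.lipschitz
  have hp0 : 0 < (p : ℝ) := by positivity
  have hp1 : 1 ≤ (p : ℝ) := by exact_mod_cast hp
  refine ⟨K + 1, hb.measurable, le_add_self, fun t x x' μ μ' => ?_, hb_int⟩
  rw [← ENNReal.rpow_le_rpow_iff hp0, edist_eq_enorm_sub, edist_eq_enorm_sub,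
    ENNReal.mul_rpow_of_nonneg _ _ hp0.le]
  refine (hK t x x' μ μ').trans (mul_le_mul' ?_ (ENNReal.add_rpow_le_rpow_add _ _ hp1))
  calc (K : ℝ≥0∞) ≤ (K + 1 : ℝ≥0) := by exact_mod_cast le_self_add
    _ ≤ ((K + 1 : ℝ≥0) : ℝ≥0∞) ^ (p : ℝ) := by
      conv_lhs => rw [← ENNReal.rpow_one ((K + 1 : ℝ≥0) : ℝ≥0∞)]
      exact ENNReal.rpow_le_rpow_of_exponent_le (by exact_mod_cast le_add_self) hp1

lemma measurable_map_section {A I F : Type*} [MeasurableSpace A] [MeasurableSpace I]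
    [MeasurableSpace F] (m : Measure I) [SFinite m] {f : A × I → F} (hf : Measurable f) :
    Measurable fun a => m.map fun i => f (a, i) := by
  refine Measure.measurable_of_measurable_coe _ fun s hs => ?_
  have : ∀ a, m.map (fun i => f (a, i)) s = m (Prod.mk a ⁻¹' (f ⁻¹' s)) := fun a => by
    rw [Measure.map_apply (by fun_prop) hs]; rfl
  simp_rw [this]
  exact measurable_measure_prodMk_left (hf hs)

namespace LipschitzDrift

lemma measurable_comp (hb : LipschitzDrift L b) (hp : 1 ≤ p) {A : Type*} [MeasurableSpace A]
    {s : A → Set.Icc (0 : ℝ) T} (hs : Measurable s) {x : A → EuclideanSpace ℝ (Fin d)}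
    (hx : Measurable x) {ν : A → PMeasure p (EuclideanSpace ℝ (Fin d))}
    (hν : Measurable fun a => (ν a).toMeasure) : Measurable fun a => b (s a) (x a) (ν a) := by
  refine measurable_comp_pMeasure hp
    (g := fun (z : Set.Icc (0 : ℝ) T × EuclideanSpace ℝ (Fin d)) μ => b z.1 z.2 μ)
    (y := fun a => (s a, x a)) ?_ (fun z μ ν h => ?_) (hs.prodMk hx) hν
  · exact hb.measurable.comp (f := fun z : (Set.Icc (0 : ℝ) T × EuclideanSpace ℝ (Fin d)) ×
      PMeasure p (EuclideanSpace ℝ (Fin d)) => (z.1.1, z.1.2, z.2)) (by fun_prop)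
  · rw [tendsto_iff_edist_tendsto_0]
    have h' := ENNReal.Tendsto.const_mul (a := (L : ℝ≥0∞)) h (Or.inr ENNReal.coe_ne_top)
    rw [mul_zero] at h'
    refine tendsto_of_tendsto_of_tendsto_of_le_of_le tendsto_const_nhds h' (fun _ => zero_le)
      fun n => ?_
    dsimp only
    rw [edist_comm]
    simpa using hb.edist_le z.1 z.2 z.2 μ (ν n)

/-- The difference from the integrable reference b(s, x₀, μ₀) is bounded uniformly in s: the path is
bounded, and each marginal has moments dominated by those of the path law. -/
lemma integrable (hb : LipschitzDrift L b) (hp : 1 ≤ p) (x : PathSpace d T)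
    (μ : PMeasure p (PathSpace d T)) :
    Integrable (fun s => b s (x s) (μ.marginal s)) (timeMeasure T) := by
  obtain ⟨x₀, μ₀, hint⟩ := hb.integrable_const
  have hmeas : Measurable fun s => b s (x s) (μ.marginal s) := by
    refine hb.measurable_comp hp measurable_id x.continuous.measurable ?_
    exact measurable_map_section μ.toMeasure
      (f := fun z : Set.Icc (0 : ℝ) T × PathSpace d T => z.2 z.1)
      (Continuous.measurable (by fun_prop))
  set C : ℝ≥0∞ := L * (edist x (ContinuousMap.const _ x₀) +
    (lpMean p μ.toMeasure (fun x => ‖x‖ₑ) + lpMean p μ₀.toMeasure fun x => ‖x‖ₑ)) with hC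
  have hCtop : C ≠ ∞ := by
    refine ENNReal.mul_ne_top ENNReal.coe_ne_top (ENNReal.add_ne_top.mpr ⟨edist_ne_top _ _, ?_⟩)
    exact ENNReal.add_ne_top.mpr ⟨(μ.lpMean_enorm_lt_top hp).ne, (μ₀.lpMean_enorm_lt_top hp).ne⟩
  have hbound : ∀ s, edist (b s (x s) (μ.marginal s)) (b s x₀ μ₀) ≤ C := fun s => by
    refine (hb.edist_le _ _ _ _ _).trans ?_
    rw [hC]
    gcongr
    · exact edist_apply_le x (ContinuousMap.const _ x₀) s
    · refine (wasserstein_le_lpMean_add_lpMean hp _ _).trans ?_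
      gcongr
      exact lpMean_marginal_le μ s
  have hdiff : Integrable (fun s => b s (x s) (μ.marginal s) - b s x₀ μ₀) (timeMeasure T) := by
    refine Integrable.of_bound (hmeas.aestronglyMeasurable.sub hint.1) C.toReal
      (ae_of_all _ fun s => ?_)
    rw [← toReal_enorm, ← edist_eq_enorm_sub]
    exact ENNReal.toReal_mono hCtop (hbound s)
  exact (hdiff.add hint).congr (ae_of_all _ fun s => sub_add_cancel _ _)

/-- With the exponential weight `4 L`, the integral equation contracts. -/
lemma weightedDist_le (hb : LipschitzDrift L b) {z z' x x' y y' : PathSpace d T}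
    {μ μ' : PMeasure p (PathSpace d T)} {r : ℝ≥0∞}
    (hx : IsIntegralPath z (fun s => b s (y s) (μ.marginal s)) x)
    (hx' : IsIntegralPath z' (fun s => b s (y' s) (μ'.marginal s)) x')
    (hr : ∀ s, wasserstein p (μ.marginal s).toMeasure (μ'.marginal s).toMeasure ≤
      ENNReal.ofReal (Real.exp (4 * L * s)) * r) :
    weightedDist (4 * L) x x' ≤ edist z z' + (weightedDist (4 * L) y y' + r) / 4 := by
  have hL : 0 < (L : ℝ) := zero_lt_one.trans_le (by exact_mod_cast hb.one_le)
  have hL' : (L : ℝ≥0∞) ≠ 0 := by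
    have := hb.one_le
    simp only [ne_eq, ENNReal.coe_eq_zero]
    rintro rfl
    simp at this
  -- The drifts differ by at most e^{4Ls} times this `c`; dividing by the weight 4L cancels L and
  -- leaves the factor 1/4.
  refine (hx.weightedDist_le (l := 4 * L) (by positivity) hx'
    (c := L * (weightedDist (4 * L) y y' + r)) fun s => ?_).trans ?_
  · refine (hb.edist_le _ _ _ _ _).trans ?_
    rw [mul_left_comm, mul_add (ENNReal.ofReal _)]
    gcongr
    · exact edist_apply_le_weightedDist _ y y' s
    · exact hr s
  · rw [ENNReal.ofReal_mul (by norm_num), ENNReal.ofReal_coe_nnreal, mul_comm (ENNReal.ofReal 4),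
      ENNReal.mul_div_mul_left _ _ hL' ENNReal.coe_ne_top]
    simp

end LipschitzDrift

lemma lpMean_weightedDist_lt_top {α : Type*} [MeasurableSpace α] {π : Measure α} (hp : 1 ≤ p)
    {x y : α → PathSpace d T} (hx : Measurable x) (hy : Measurable y) {l : ℝ} (hl : 0 ≤ l)
    (hx' : lpMean p π (fun a => ‖x a‖ₑ) < ∞) (hy' : lpMean p π (fun a => ‖y a‖ₑ) < ∞) :
    lpMean p π (fun a => weightedDist l (x a) (y a)) < ∞ := by
  refine lt_of_le_of_lt ?_ (ENNReal.add_lt_top.mpr ⟨hx', hy'⟩)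
  refine le_trans (lpMean_mono fun a => ?_) (lpMean_add_le hp (by fun_prop) (by fun_prop))
  refine (weightedDist_le_edist hl _ _).trans ?_
  rw [edist_eq_enorm_sub]; exact enorm_sub_le

/-- Absorption: half of r moves to the left, which is legitimate only because r is finite. -/
lemma le_two_mul_of_le_add_div_four {r a : ℝ≥0∞} (hr : r ≠ ∞) (h : r ≤ a + (r + r) / 4) :
    r ≤ 2 * a := by
  have h2 : (r + r) / 4 = r / 2 := by
    rw [← two_mul, show (4 : ℝ≥0∞) = 2 * 2 by norm_num,
      ENNReal.mul_div_mul_left _ _ two_ne_zero ENNReal.ofNat_ne_top]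
  rw [h2] at h
  have h3 : r / 2 + r / 2 ≤ a + r / 2 := by rwa [ENNReal.add_halves]
  have h4 : r / 2 ≤ a := (ENNReal.add_le_add_iff_right (ENNReal.div_ne_top hr two_ne_zero)).mp h3
  calc r = r / 2 + r / 2 := (ENNReal.add_halves r).symm
    _ ≤ a + a := add_le_add h4 h4
    _ = 2 * a := (two_mul a).symm

/-- Stability of the mean field equation: the laws of the solutions depend on the law of the input
in a Lipschitz way. -/
theorem LipschitzDrift.wasserstein_le (hb : LipschitzDrift L b) (hp : 1 ≤ p) {α : Type*}
    [MeasurableSpace α] {π : Measure α} {z z' x x' : α → PathSpace d T} (hz : Measurable z)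
    (hz' : Measurable z') (hx : Measurable x) (hx' : Measurable x')
    {μ μ' : PMeasure p (PathSpace d T)} (hμ : π.map x = μ.toMeasure)
    (hμ' : π.map x' = μ'.toMeasure)
    (hsol : ∀ᵐ a ∂π, IsIntegralPath (z a) (fun s => b s (x a s) (μ.marginal s)) (x a))
    (hsol' : ∀ᵐ a ∂π, IsIntegralPath (z' a) (fun s => b s (x' a s) (μ'.marginal s)) (x' a)) :
    wasserstein p μ.toMeasure μ'.toMeasure ≤
      ENNReal.ofReal (Real.exp (4 * L * T)) * (2 * lpMean p π fun a => edist (z a) (z' a)) := by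
  have hl : 0 ≤ 4 * (L : ℝ) := by positivity
  have := isProbabilityMeasure_of_map hx hμ
  set r := lpMean p π fun a => weightedDist (4 * L) (x a) (x' a) with hr
  have hwm := measurable_weightedDist_comp (l := 4 * L) hx hx'
  have hrtop : r < ∞ := by
    refine lpMean_weightedDist_lt_top hp hx hx' hl ?_ ?_
    · rw [← lpMean_map (f := fun x => ‖x‖ₑ) (by fun_prop) hx, hμ]
      exact μ.lpMean_enorm_lt_top hp
    · rw [← lpMean_map (f := fun x => ‖x‖ₑ) (by fun_prop) hx', hμ']
      exact μ'.lpMean_enorm_lt_top hp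
  have hpt : ∀ᵐ a ∂π, weightedDist (4 * L) (x a) (x' a) ≤
      edist (z a) (z' a) + 4⁻¹ * (weightedDist (4 * L) (x a) (x' a) + r) := by
    filter_upwards [hsol, hsol'] with a ha ha'
    have := hb.weightedDist_le ha ha' (wasserstein_marginal_le hp hx hx' hμ hμ')
    rwa [div_eq_mul_inv, mul_comm _ (4⁻¹ : ℝ≥0∞)] at this
  -- Minkowski applied to the pointwise bound; one r comes from the distance of the paths, the other
  -- from that of their laws.
  have hle : r ≤ (lpMean p π fun a => edist (z a) (z' a)) + (r + r) / 4 := by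
    calc r ≤ _ := lpMean_mono_ae hpt
      _ ≤ _ := lpMean_add_le hp (by fun_prop) ((hwm.add_const r).const_mul _).aemeasurable
      _ ≤ _ := by
        gcongr
        rw [lpMean_const_mul hp _ (hwm.add_const r).aemeasurable, div_eq_mul_inv,
          mul_comm _ (4⁻¹ : ℝ≥0∞)]
        gcongr
        refine (lpMean_add_le hp hwm.aemeasurable (by fun_prop)).trans ?_
        rw [lpMean_const hp]
  rw [← hμ, ← hμ']
  calc _ ≤ lpMean p π fun a => edist (x a) (x' a) := wasserstein_map_map_le π hx hx'
    _ ≤ lpMean p π fun a => ENNReal.ofReal (Real.exp (4 * L * T)) *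
          weightedDist (4 * L) (x a) (x' a) :=
        lpMean_mono fun a => edist_le_weightedDist hl _ _
    _ = ENNReal.ofReal (Real.exp (4 * L * T)) * r := lpMean_const_mul hp _ hwm.aemeasurable
    _ ≤ _ := by gcongr; exact le_two_mul_of_le_add_div_four hrtop.ne hle

end MeanField

/-! ### Picard iteration with a parameter -/

lemma exists_tendsto_of_edist_le_geometric_two {F : Type*} [PseudoEMetricSpace F]
    [CompleteSpace F] {x : ℕ → F} {C : ℝ≥0∞} (hC : C ≠ ∞)
    (h : ∀ n, edist (x n) (x (n + 1)) ≤ C / 2 ^ n) :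
    ∃ y, Tendsto x atTop (𝓝 y) ∧ ∀ n, edist (x n) y ≤ 2 * C / 2 ^ n := by
  obtain ⟨y, hy⟩ := cauchySeq_tendsto_of_complete (cauchySeq_of_edist_le_geometric_two C hC h)
  exact ⟨y, hy, edist_le_of_edist_le_geometric_two_of_tendsto C h hy⟩

section Picard

variable {d : ℕ} {T : ℝ} {p : ℝ≥0} {Θ I : Type*} [MeasurableSpace Θ] [MeasurableSpace I]

/-- Measurable families of random paths with finite `p`-th moment, with a parameter in `Θ`. -/
structure PathFamily (d : ℕ) (T : ℝ) (p : ℝ≥0) (Θ : Type*) [MeasurableSpace Θ] {I : Type*}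
    [MeasurableSpace I] (m : Measure I) where
  /-- the paths -/
  path : Θ × I → PathSpace d T
  measurable : Measurable path
  moment : ∀ θ, lpMean p m (fun i => ‖path (θ, i)‖ₑ) < ∞

namespace PathFamily

variable {m : Measure I}

attribute [fun_prop] PathFamily.measurable

lemma measurable_section (X : PathFamily d T p Θ m) (θ : Θ) :
    Measurable fun i => X.path (θ, i) := X.measurable.comp measurable_prodMk_left

variable [IsProbabilityMeasure m]

/-- The law of the paths for a given parameter. -/
def law (hp : 1 ≤ p) (X : PathFamily d T p Θ m) (θ : Θ) : PMeasure p (PathSpace d T) :=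
  PMeasure.ofMap hp m (fun i => X.path (θ, i)) (X.measurable_section θ) (X.moment θ)

/-- The zero process. -/
def zero (hp : 1 ≤ p) (m : Measure I) [IsProbabilityMeasure m] : PathFamily d T p Θ m where
  path _ := 0
  measurable := measurable_const
  moment θ := by simp [lpMean_const hp]

variable {b : Set.Icc (0 : ℝ) T → EuclideanSpace ℝ (Fin d) →
    PMeasure p (EuclideanSpace ℝ (Fin d)) → EuclideanSpace ℝ (Fin d)} {L : ℝ≥0}

/-- The Picard map of the mean field equation, at the level of paths. -/
def stepPath (hb : LipschitzDrift L b) (hp : 1 ≤ p) (Z X : PathFamily d T p Θ m) (z : Θ × I) :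
    PathSpace d T :=
  Z.path z + primitivePath _ (hb.integrable hp (X.path z) (X.law hp z.1))

lemma isIntegralPath_stepPath (hb : LipschitzDrift L b) (hp : 1 ≤ p)
    (Z X : PathFamily d T p Θ m) (z : Θ × I) :
    IsIntegralPath (Z.path z) (fun s => b s (X.path z s) ((X.law hp z.1).marginal s))
      (stepPath hb hp Z X z) :=
  isIntegralPath_add_primitivePath _ _

/-- Evaluations determine measurability, so it is enough that the integrand be jointly measurable in
(θ, i, s). Its measure argument is the image of the fixed m under a jointly measurable map, hence
measurable in (θ, s). -/
lemma measurable_stepPath (hb : LipschitzDrift L b) (hp : 1 ≤ p) (Z X : PathFamily d T p Θ m) :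
    Measurable (stepPath hb hp Z X) := by
  have heval : Measurable fun z : PathSpace d T × Set.Icc (0 : ℝ) T => z.1 z.2 :=
    Continuous.measurable (by fun_prop)
  refine measurable_pathSpace fun t => ?_
  refine ((continuous_eval_const t).measurable.comp Z.measurable).add ?_
  have hF : Measurable fun z : (Θ × I) × Set.Icc (0 : ℝ) T =>
      b z.2 (X.path z.1 z.2) ((X.law hp z.1.1).marginal z.2) := by
    refine hb.measurable_comp hp measurable_snd
      (heval.comp ((X.measurable.comp measurable_fst).prodMk measurable_snd)) ?_
    have h := measurable_map_section m (A := Θ × Set.Icc (0 : ℝ) T)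
      (f := fun a => X.path (a.1.1, a.2) a.1.2)
      (heval.comp (g := fun z : PathSpace d T × Set.Icc (0 : ℝ) T => z.1 z.2)
        (f := fun a : (Θ × Set.Icc (0 : ℝ) T) × I => (X.path (a.1.1, a.2), a.1.2)) (by fun_prop))
    convert h.comp (f := fun z : (Θ × I) × Set.Icc (0 : ℝ) T => (z.1.1, z.2)) (by fun_prop)
      using 1
    funext z
    exact (Measure.map_map (f := fun i => X.path (z.1.1, i)) (continuous_eval_const z.2).measurable
      (X.measurable_section z.1.1))
  exact (hF.stronglyMeasurable.integral_prod_right'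
    (ν := (timeMeasure T).restrict (Set.Iic t))).measurable

lemma wasserstein_law_marginal_le (hp : 1 ≤ p) (X Y : PathFamily d T p Θ m) (l : ℝ) (θ : Θ)
    (s : Set.Icc (0 : ℝ) T) :
    wasserstein p ((X.law hp θ).marginal s).toMeasure ((Y.law hp θ).marginal s).toMeasure ≤
      ENNReal.ofReal (Real.exp (l * s)) *
        lpMean p m fun i => weightedDist l (X.path (θ, i)) (Y.path (θ, i)) :=
  wasserstein_marginal_le hp (X.measurable_section θ) (Y.measurable_section θ) rfl rfl s

lemma weightedDist_stepPath_le (hb : LipschitzDrift L b) (hp : 1 ≤ p)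
    (Z Z' X X' : PathFamily d T p Θ m) (θ : Θ) (i : I) :
    weightedDist (4 * L) (stepPath hb hp Z X (θ, i)) (stepPath hb hp Z' X' (θ, i)) ≤
      edist (Z.path (θ, i)) (Z'.path (θ, i)) +
        (weightedDist (4 * L) (X.path (θ, i)) (X'.path (θ, i)) +
          lpMean p m fun i => weightedDist (4 * L) (X.path (θ, i)) (X'.path (θ, i))) / 4 :=
  hb.weightedDist_le (isIntegralPath_stepPath hb hp Z X _) (isIntegralPath_stepPath hb hp Z' X' _)
    (wasserstein_law_marginal_le hp X X' _ θ)

/-- The image of the zero process under the Picard map without input. -/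
def basePath (hb : LipschitzDrift L b) (hp : 1 ≤ p) : PathSpace d T :=
  primitivePath _ (hb.integrable hp 0 ((zero hp (Measure.dirac ()) :
    PathFamily d T p Unit (Measure.dirac ())).law hp ()))

/-- The law of the zero process is the Dirac mass at 0 for every parameter and every m, so the
primitive is one deterministic path, `basePath`. -/
lemma stepPath_zero (hb : LipschitzDrift L b) (hp : 1 ≤ p) (Z : PathFamily d T p Θ m)
    (z : Θ × I) : stepPath hb hp Z (zero hp m) z = Z.path z + basePath hb hp := by
  have : (zero hp m : PathFamily d T p Θ m).law hp z.1 = (zero hp (Measure.dirac ()) :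
      PathFamily d T p Unit (Measure.dirac ())).law hp () := by
    refine PMeasure.ext_toMeasure ?_
    simp [law, zero]
  unfold stepPath basePath
  congr 2
  funext s
  rw [this]
  rfl

/-- The Picard map is Lipschitz, so its image is compared with that of the zero process, which is
explicit. -/
lemma lpMean_stepPath_lt_top (hb : LipschitzDrift L b) (hp : 1 ≤ p)
    (Z X : PathFamily d T p Θ m) (θ : Θ) :
    lpMean p m (fun i => ‖stepPath hb hp Z X (θ, i)‖ₑ) < ∞ := by
  have hl : 0 ≤ 4 * (L : ℝ) := by positivity
  set r := lpMean p m fun i => weightedDist (4 * L) (X.path (θ, i)) 0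
  have hr : r < ∞ := lpMean_weightedDist_lt_top hp (X.measurable_section θ) measurable_const hl
    (X.moment θ) (by simp [lpMean_const hp])
  set E := ENNReal.ofReal (Real.exp (4 * L * T))
  have hXm := X.measurable_section θ
  have hZm := Z.measurable_section θ
  have hw : Measurable fun i => weightedDist (4 * L) (X.path (θ, i)) 0 :=
    measurable_weightedDist_comp hXm measurable_const
  have hpt : ∀ i, ‖stepPath hb hp Z X (θ, i)‖ₑ ≤ (E * (weightedDist (4 * L) (X.path (θ, i)) 0) +
      ‖Z.path (θ, i)‖ₑ) + (E * r + ‖basePath hb hp‖ₑ) := fun i => by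
    have h1 := weightedDist_stepPath_le hb hp Z Z X (zero hp m) θ i
    rw [stepPath_zero, edist_self, zero_add] at h1
    have h2 := (edist_le_weightedDist hl _ _).trans (mul_le_mul' le_rfl h1)
    calc ‖stepPath hb hp Z X (θ, i)‖ₑ = edist (stepPath hb hp Z X (θ, i)) 0 := by simp
      _ ≤ edist (stepPath hb hp Z X (θ, i)) (Z.path (θ, i) + basePath hb hp) +
          edist (Z.path (θ, i) + basePath hb hp) 0 := edist_triangle _ _ _
      _ ≤ E * (weightedDist (4 * L) (X.path (θ, i)) 0 + r) +
          (‖Z.path (θ, i)‖ₑ + ‖basePath hb hp‖ₑ) := by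
          refine add_le_add (h2.trans ?_) ?_
          · gcongr
            refine ENNReal.div_le_of_le_mul (le_mul_of_one_le_right zero_le ?_)
            norm_num
          · rw [edist_zero_right]; exact enorm_add_le (Z.path (θ, i)) (basePath hb hp)
      _ = _ := by ring
  refine (lpMean_mono hpt).trans_lt ?_
  refine (lpMean_add_le hp (((hw.const_mul _).add (by fun_prop)).aemeasurable)
    aemeasurable_const).trans_lt ?_
  rw [lpMean_const hp]
  have hE : E < ∞ := ENNReal.ofReal_lt_top
  refine ENNReal.add_lt_top.mpr ⟨(lpMean_add_le hp (hw.const_mul _).aemeasurable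
    (by fun_prop)).trans_lt ?_, ENNReal.add_lt_top.mpr ⟨ENNReal.mul_lt_top hE hr,
      enorm_lt_top⟩⟩
  rw [lpMean_const_mul hp _ hw.aemeasurable]
  exact ENNReal.add_lt_top.mpr ⟨ENNReal.mul_lt_top hE hr, Z.moment θ⟩

/-- The Picard map of the mean field equation. -/
def step (hb : LipschitzDrift L b) (hp : 1 ≤ p) (Z X : PathFamily d T p Θ m) :
    PathFamily d T p Θ m where
  path := stepPath hb hp Z X
  measurable := measurable_stepPath hb hp Z X
  moment := lpMean_stepPath_lt_top hb hp Z X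

/-- The Picard iterates. -/
def picard (hb : LipschitzDrift L b) (hp : 1 ≤ p) (Z : PathFamily d T p Θ m) :
    ℕ → PathFamily d T p Θ m
  | 0 => zero hp m
  | n + 1 => step hb hp Z (picard hb hp Z n)

/-- The pointwise recursion contains the L^p mean of the previous increment, so the pointwise and
the mean bound must be propagated together. Each contributes at most one unit against the factor
1/4, whence the ratio 1/2. -/
lemma weightedDist_picard_le (hb : LipschitzDrift L b) (hp : 1 ≤ p)
    (Z : PathFamily d T p Θ m) (θ : Θ) {U : I → ℝ≥0∞}
    (hU : ∀ i, ‖Z.path (θ, i) + basePath hb hp‖ₑ ≤ U i) (n : ℕ) :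
    (∀ i, weightedDist (4 * L) ((picard hb hp Z n).path (θ, i))
      ((picard hb hp Z (n + 1)).path (θ, i)) ≤ (U i + lpMean p m U) / 2 ^ n) ∧
    lpMean p m (fun i => weightedDist (4 * L) ((picard hb hp Z n).path (θ, i))
      ((picard hb hp Z (n + 1)).path (θ, i))) ≤ lpMean p m U / 2 ^ n := by
  have hl : 0 ≤ 4 * (L : ℝ) := by positivity
  induction n with
  | zero =>
    have h : ∀ i, weightedDist (4 * L) ((picard hb hp Z 0).path (θ, i))
        ((picard hb hp Z 1).path (θ, i)) ≤ U i := fun i => by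
      refine (weightedDist_le_edist hl _ _).trans ?_
      rw [edist_comm]
      change edist (stepPath hb hp Z (zero hp m) (θ, i)) 0 ≤ _
      rw [stepPath_zero, edist_zero_right]
      exact hU i
    exact ⟨fun i => by simpa using (h i).trans le_self_add, by simpa using lpMean_mono h⟩
  | succ n ih =>
    obtain ⟨ih₁, ih₂⟩ := ih
    set ρ : I → ℝ≥0∞ := fun i => weightedDist (4 * L) ((picard hb hp Z n).path (θ, i))
      ((picard hb hp Z (n + 1)).path (θ, i)) with hρ
    have hρm : Measurable ρ := measurable_weightedDist_comp
      (measurable_section _ θ) (measurable_section _ θ)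
    have hpt : ∀ i, weightedDist (4 * L) ((picard hb hp Z (n + 1)).path (θ, i))
        ((picard hb hp Z (n + 1 + 1)).path (θ, i)) ≤ 4⁻¹ * (ρ i + lpMean p m ρ) := fun i => by
      have h := weightedDist_stepPath_le hb hp Z Z (picard hb hp Z n) (picard hb hp Z (n + 1)) θ i
      rwa [edist_self, zero_add, div_eq_mul_inv, mul_comm _ (4⁻¹ : ℝ≥0∞)] at h
    have hhalf : ∀ a : ℝ≥0∞, 4⁻¹ * (2 * a / 2 ^ n) = a / 2 ^ (n + 1) := fun a => by
      have : (4⁻¹ : ℝ≥0∞) * 2 = 2⁻¹ := by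
        rw [mul_comm, ← div_eq_mul_inv, show (4 : ℝ≥0∞) = 2 * 2 by norm_num]
        simpa using ENNReal.mul_div_mul_left 1 2 two_ne_zero ENNReal.ofNat_ne_top
      rw [mul_div_assoc, ← mul_assoc, this, div_eq_mul_inv, div_eq_mul_inv, pow_succ,
        ENNReal.mul_inv (Or.inr ENNReal.ofNat_ne_top) (Or.inr two_ne_zero)]
      ring
    constructor
    · intro i
      rw [← hhalf]
      refine (hpt i).trans ?_
      gcongr
      calc ρ i + lpMean p m ρ ≤ (U i + lpMean p m U) / 2 ^ n + lpMean p m U / 2 ^ n :=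
            add_le_add (ih₁ i) ih₂
        _ ≤ (U i + lpMean p m U) / 2 ^ n + (U i + lpMean p m U) / 2 ^ n := by
            gcongr; exact le_add_self
        _ = _ := by rw [← ENNReal.add_div, two_mul]
    · rw [← hhalf]
      calc _ ≤ lpMean p m fun i => 4⁻¹ * (ρ i + lpMean p m ρ) := lpMean_mono hpt
        _ = 4⁻¹ * lpMean p m fun i => (ρ i + lpMean p m ρ) :=
            lpMean_const_mul hp _ (hρm.add_const _).aemeasurable
        _ ≤ 4⁻¹ * (lpMean p m ρ + lpMean p m ρ) := by
            gcongr
            refine (lpMean_add_le hp hρm.aemeasurable aemeasurable_const).trans ?_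
            rw [lpMean_const hp]
        _ ≤ 4⁻¹ * (lpMean p m U / 2 ^ n + lpMean p m U / 2 ^ n) := by gcongr
        _ = _ := by rw [← ENNReal.add_div, two_mul]

/-- Existence for the mean field equation with a parameter, with joint measurability and an
a priori bound. -/
theorem exists_isIntegralPath (hb : LipschitzDrift L b) (hp : 1 ≤ p)
    (Z : PathFamily d T p Θ m) :
    ∃ X : PathFamily d T p Θ m,
      (∀ z, IsIntegralPath (Z.path z) (fun s => b s (X.path z s) ((X.law hp z.1).marginal s))
        (X.path z)) ∧
      ∀ θ i, ‖X.path (θ, i)‖ₑ ≤ 2 * (ENNReal.ofReal (Real.exp (4 * L * T)) *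
        ((‖Z.path (θ, i)‖ₑ + ‖basePath hb hp‖ₑ) +
          lpMean p m fun i => ‖Z.path (θ, i)‖ₑ + ‖basePath hb hp‖ₑ)) := by
  have hl : 0 ≤ 4 * (L : ℝ) := by positivity
  set c := ‖basePath hb hp‖ₑ with hc
  have hctop : c < ∞ := enorm_lt_top
  set E := ENNReal.ofReal (Real.exp (4 * L * T)) with hE
  have hEtop : E < ∞ := ENNReal.ofReal_lt_top
  set R : Θ → ℝ≥0∞ := fun θ => lpMean p m fun i => ‖Z.path (θ, i)‖ₑ + c with hR
  have hZm := Z.measurable_section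
  have hRtop : ∀ θ, R θ < ∞ := fun θ => by
    refine (lpMean_add_le hp (by fun_prop) aemeasurable_const).trans_lt ?_
    rw [lpMean_const hp]
    exact ENNReal.add_lt_top.mpr ⟨Z.moment θ, hctop⟩
  set C : Θ × I → ℝ≥0∞ := fun z => E * ((‖Z.path z‖ₑ + c) + R z.1) with hC
  have hCtop : ∀ z, C z ≠ ∞ := fun z => by
    refine (ENNReal.mul_lt_top hEtop ?_).ne
    exact ENNReal.add_lt_top.mpr ⟨ENNReal.add_lt_top.mpr ⟨enorm_lt_top, hctop⟩, hRtop _⟩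
  have hCm : ∀ θ, Measurable fun i => C (θ, i) := fun θ => by
    have hUm : Measurable fun i => ‖Z.path (θ, i)‖ₑ + c := (hZm θ).enorm.add_const c
    exact (hUm.add_const (R θ)).const_mul E
  have hCmoment : ∀ θ, lpMean p m (fun i => C (θ, i)) < ∞ := fun θ => by
    have hUm : Measurable fun i => ‖Z.path (θ, i)‖ₑ + c := (hZm θ).enorm.add_const c
    have h : lpMean p m (fun i => C (θ, i)) =
        E * lpMean p m fun i => (‖Z.path (θ, i)‖ₑ + c) + R θ :=
      lpMean_const_mul (f := fun i => (‖Z.path (θ, i)‖ₑ + c) + R θ) hp E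
        (hUm.add_const (R θ)).aemeasurable
    rw [h]
    refine ENNReal.mul_lt_top hEtop
      ((lpMean_add_le hp hUm.aemeasurable aemeasurable_const).trans_lt ?_)
    rw [lpMean_const hp]
    exact ENNReal.add_lt_top.mpr ⟨hRtop θ, hRtop θ⟩
  set Y := picard hb hp Z with hY
  have hstep : ∀ z n, edist ((Y n).path z) ((Y (n + 1)).path z) ≤ C z / 2 ^ n := by
    rintro ⟨θ, i⟩ n
    refine (edist_le_weightedDist hl _ _).trans ?_
    have h := (weightedDist_picard_le hb hp Z θ (U := fun i => ‖Z.path (θ, i)‖ₑ + c)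
      (fun i => enorm_add_le (Z.path (θ, i)) (basePath hb hp)) n).1 i
    rw [hC, mul_div_assoc]
    exact mul_le_mul' le_rfl h
  -- The increments are summable for every θ and i, so the limit exists everywhere and is jointly
  -- measurable with no exceptional set.
  choose x hx hdist using fun z => exists_tendsto_of_edist_le_geometric_two (hCtop z) (hstep z)
  have hbound : ∀ z, ‖x z‖ₑ ≤ 2 * C z := fun z => by
    have := hdist z 0
    rw [edist_comm] at this
    simpa [hY, picard, zero] using this
  have hxm : Measurable x := measurable_of_tendsto_metrizable (fun n => (Y n).measurable)
    (tendsto_pi_nhds.mpr hx)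
  let X : PathFamily d T p Θ m := ⟨x, hxm, fun θ => by
    refine (lpMean_mono fun i => hbound (θ, i)).trans_lt ?_
    rw [lpMean_const_mul hp _ (hCm θ).aemeasurable]
    exact ENNReal.mul_lt_top ENNReal.ofNat_lt_top (hCmoment θ)⟩
  -- The distance to the limit is at most 2^{1-n} C, both pointwise and, since C has a finite L^p
  -- mean, in the mean; the Picard map therefore passes to the limit.
  have hfix : ∀ z, x z = stepPath hb hp Z X z := by
    rintro ⟨θ, i⟩
    set D := E * ((C (θ, i) + lpMean p m fun i => C (θ, i)) * 2) with hD
    have hDtop : D ≠ ∞ := (ENNReal.mul_lt_top hEtop (ENNReal.mul_lt_top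
      (ENNReal.add_lt_top.mpr ⟨(hCtop _).lt_top, hCmoment θ⟩) ENNReal.ofNat_lt_top)).ne
    have hle : ∀ n, edist ((Y (n + 1)).path (θ, i)) (stepPath hb hp Z X (θ, i)) ≤
        D * (2⁻¹) ^ n := fun n => by
      have hw : ∀ i, weightedDist (4 * L) ((Y n).path (θ, i)) (X.path (θ, i)) ≤
          (2 * (2⁻¹) ^ n) * C (θ, i) := fun i =>
        (weightedDist_le_edist hl _ _).trans ((hdist (θ, i) n).trans_eq (by
          rw [div_eq_mul_inv, ENNReal.inv_pow]; ring))
      have h := weightedDist_stepPath_le hb hp Z Z (Y n) X θ i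
      rw [edist_self, zero_add] at h
      refine (edist_le_weightedDist hl _ _).trans ?_
      calc _ ≤ E * ((2 * (2⁻¹) ^ n) * C (θ, i) +
              lpMean p m fun i => (2 * (2⁻¹) ^ n) * C (θ, i)) := by
            gcongr
            refine h.trans ((ENNReal.div_le_of_le_mul (le_mul_of_one_le_right zero_le ?_)).trans
              (add_le_add (hw i) (lpMean_mono hw)))
            norm_num
        _ = D * (2⁻¹) ^ n := by
            rw [lpMean_const_mul hp _ (hCm θ).aemeasurable, hD]; ring
    refine tendsto_nhds_unique ((tendsto_add_atTop_iff_nat 1).mpr (hx (θ, i))) ?_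
    rw [tendsto_iff_edist_tendsto_0]
    have h0 : Tendsto (fun n : ℕ => D * (2⁻¹ : ℝ≥0∞) ^ n) atTop (𝓝 0) := by
      have := ENNReal.Tendsto.const_mul (a := D)
        (ENNReal.tendsto_pow_atTop_nhds_zero_of_lt_one (r := 2⁻¹) (by norm_num))
        (Or.inr hDtop)
      simpa using this
    exact tendsto_of_tendsto_of_tendsto_of_le_of_le tendsto_const_nhds h0 (fun _ => zero_le) hle
  refine ⟨X, fun z => ?_, fun θ i => hbound (θ, i)⟩
  have h := isIntegralPath_stepPath hb hp Z X z
  rwa [← hfix z] at h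

end PathFamily

end Picard

/-! ### The law of large numbers for empirical measures -/

section LawOfLargeNumbers

lemma isProbabilityMeasure_empiricalMeasure {E : Type*} [MeasurableSpace E] {N : ℕ} (hN : N ≠ 0)
    (y : Fin N → E) : IsProbabilityMeasure (empiricalMeasure y) := by
  constructor
  simp [empiricalMeasure, ENNReal.inv_mul_cancel (Nat.cast_ne_zero.mpr hN)
    (ENNReal.natCast_ne_top N)]

lemma map_empiricalMeasure {E F : Type*} [MeasurableSpace E] [MeasurableSpace F] {N : ℕ}
    (y : Fin N → E) {f : E → F} (hf : Measurable f) :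
    (empiricalMeasure y).map f = empiricalMeasure fun i => f (y i) := by
  simp [empiricalMeasure, Measure.map_finset_sum hf.aemeasurable, Measure.map_dirac' hf]

lemma lintegral_empiricalMeasure {E : Type*} [MeasurableSpace E] {N : ℕ} (y : Fin N → E)
    {f : E → ℝ≥0∞} (hf : Measurable f) :
    ∫⁻ x, f x ∂empiricalMeasure y = (N : ℝ≥0∞)⁻¹ * ∑ i, f (y i) := by
  rw [empiricalMeasure, lintegral_smul_measure, lintegral_finsetSum_measure]
  simp [lintegral_dirac' _ hf]

variable {Ω E : Type*} [MeasurableSpace Ω] {P : Measure Ω} [MeasurableSpace E] {Y : ℕ → Ω → E}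

/-- The strong law for the real variables f(Y_i), which needs only pairwise independence. It is used
for the masses of cells and for quantization costs. -/
lemma tendsto_lintegral_empiricalMeasure (hY : ∀ i, Measurable (Y i))
    (hindep : Pairwise fun i j => IndepFun (Y i) (Y j) P)
    (hident : ∀ i, IdentDistrib (Y i) (Y 0) P P) {f : E → ℝ≥0} (hf : Measurable f)
    (hfin : ∫⁻ x, f x ∂P.map (Y 0) < ∞) :
    ∀ᵐ ω ∂P, Tendsto (fun N : ℕ => ∫⁻ x, f x ∂empiricalMeasure fun i : Fin N => Y i ω) atTop
      (𝓝 (∫⁻ x, f x ∂P.map (Y 0))) := by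
  have hg : Measurable fun x => (f x : ℝ) := hf.coe_nnreal_real
  rw [lintegral_map hf.coe_nnreal_ennreal (hY 0)] at hfin ⊢
  have hint : Integrable (fun ω => (f (Y 0 ω) : ℝ)) P := by
    refine ⟨(hg.comp (hY 0)).aestronglyMeasurable, ?_⟩
    simpa [HasFiniteIntegral] using hfin
  have hslln := strong_law_ae_real (fun i ω => (f (Y i ω) : ℝ)) hint
    (fun i j hij => (hindep hij).comp hg hg) (fun i => (hident i).comp hg)
  filter_upwards [hslln] with ω hω
  have h := ENNReal.tendsto_ofReal hω
  have hlim : ENNReal.ofReal (∫ ω, (f (Y 0 ω) : ℝ) ∂P) = ∫⁻ ω, f (Y 0 ω) ∂P := by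
    rw [ofReal_integral_eq_lintegral_ofReal hint (ae_of_all _ fun _ => NNReal.coe_nonneg _)]
    simp
  rw [hlim] at h
  refine h.congr' ?_
  filter_upwards [eventually_gt_atTop 0] with N hN
  rw [lintegral_empiricalMeasure _ hf.coe_nnreal_ennreal,
    Fin.sum_univ_eq_sum_range (fun i => (f (Y i ω) : ℝ≥0∞)) N,
    ENNReal.ofReal_div_of_pos (by exact_mod_cast hN), ENNReal.ofReal_natCast, div_eq_mul_inv,
    mul_comm, ENNReal.ofReal_sum_of_nonneg fun _ _ => NNReal.coe_nonneg _]
  simp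

end LawOfLargeNumbers

/-- The law of large numbers in Wasserstein distance. -/
theorem tendsto_wasserstein_empiricalMeasure {Ω E : Type*} [MeasurableSpace Ω] {P : Measure Ω}
    [IsProbabilityMeasure P] [NormedAddCommGroup E] [MeasurableSpace E] [BorelSpace E]
    [SecondCountableTopology E] [StandardBorelSpace E] {p : ℝ≥0} (hp : 1 ≤ p) {Y : ℕ → Ω → E}
    (hY : ∀ i, Measurable (Y i)) (hindep : Pairwise fun i j => IndepFun (Y i) (Y j) P)
    (hident : ∀ i, IdentDistrib (Y i) (Y 0) P P)
    (hmoment : lpMean p (P.map (Y 0)) (fun x => ‖x‖ₑ) < ∞) :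
    ∀ᵐ ω ∂P, Tendsto (fun N : ℕ =>
      wasserstein p (empiricalMeasure fun i : Fin N => Y i ω) (P.map (Y 0))) atTop (𝓝 0) := by
  have hp0 : 0 < (p : ℝ) := by positivity
  set m := P.map (Y 0) with hm
  have : IsProbabilityMeasure m := Measure.isProbabilityMeasure_map (hY 0).aemeasurable
  have hq : ∀ n, Measurable (quantizer E n) := fun n => (quantizer E n).measurable
  have hdist : ∀ n, Measurable fun x => edist x (quantizer E n x) := fun n =>
    measurable_id.edist (hq n)
  -- There are countably many quantizers with finitely many cells each, so one null set serves them
  -- all.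
  have hweights : ∀ᵐ ω ∂P, ∀ n, ∀ y : (quantizer E n).range,
      Tendsto (fun N : ℕ => (empiricalMeasure fun i : Fin N => Y i ω) (quantizer E n ⁻¹' {y.1}))
        atTop (𝓝 (m (quantizer E n ⁻¹' {y.1}))) := by
    refine ae_all_iff.mpr fun n => ae_all_iff.mpr fun y => ?_
    have hs := (quantizer E n).measurableSet_fiber y.1
    have h := tendsto_lintegral_empiricalMeasure hY hindep hident
      (f := (quantizer E n ⁻¹' {y.1}).indicator 1) (measurable_one.indicator hs)
    have hcoe : ∀ μ : Measure E, ∫⁻ x, ((quantizer E n ⁻¹' {y.1}).indicator (1 : E → ℝ≥0) x : ℝ≥0)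
        ∂μ = μ (quantizer E n ⁻¹' {y.1}) := fun μ => by
      simp_rw [ENNReal.coe_indicator]
      simp only [Pi.one_apply, ENNReal.coe_one]
      exact lintegral_indicator_one hs
    simp_rw [hcoe] at h
    exact h (measure_lt_top _ _)
  have hcost : ∀ᵐ ω ∂P, ∀ n,
      Tendsto (fun N : ℕ => lpMean p (empiricalMeasure fun i : Fin N => Y i ω)
        fun x => edist x (quantizer E n x)) atTop
        (𝓝 (lpMean p m fun x => edist x (quantizer E n x))) := by
    refine ae_all_iff.mpr fun n => ?_
    have hcoe : ∀ x : E, ((nndist x (quantizer E n x) ^ (p : ℝ) : ℝ≥0) : ℝ≥0∞) =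
        edist x (quantizer E n x) ^ (p : ℝ) := fun x => by
      rw [ENNReal.coe_rpow_of_nonneg _ hp0.le, edist_nndist]
    have h := tendsto_lintegral_empiricalMeasure hY hindep hident
      (f := fun x => nndist x (quantizer E n x) ^ (p : ℝ))
      ((measurable_id.nndist (hq n)).pow_const _)
    simp_rw [hcoe] at h
    have hfin : lpMean p m (fun x => edist x (quantizer E n x)) < ∞ := by
      refine lt_of_le_of_lt (lpMean_mono fun x => ?_) ((lpMean_add_le hp (by fun_prop)
        (hq n).enorm.aemeasurable).trans_lt
          (ENNReal.add_lt_top.mpr ⟨hmoment, lpMean_quantizer_lt_top hp n⟩))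
      rw [edist_eq_enorm_sub]; exact enorm_sub_le
    filter_upwards [h ((lpMean_lt_top_iff hp).mp hfin)] with ω hω
    exact hω.ennrpow_const _
  filter_upwards [hweights, hcost] with ω hw hc
  refine ENNReal.tendsto_nhds_zero.mpr fun δ hδ => ?_
  have hlimn : Tendsto (fun n => (lpMean p m fun x => edist x (quantizer E n x)) + 0 +
      lpMean p m fun x => edist x (quantizer E n x)) atTop (𝓝 (0 + 0 + 0)) :=
    ((tendsto_lpMean_quantizer hp hmoment).add tendsto_const_nhds).add
      (tendsto_lpMean_quantizer hp hmoment)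
  rw [add_zero, add_zero] at hlimn
  -- The chain is: empirical measure, its quantization, the quantization of m, m. The outer two
  -- costs tend to the quantization error of m, and the middle one to zero as N → ∞; n is chosen to
  -- make twice that error less than δ.
  obtain ⟨n, hn⟩ := (hlimn.eventually_lt_const hδ).exists
  set q := quantizer E n
  set D := ∑ j : q.range, ∑ k : q.range, edist j.1 k.1 ^ (p : ℝ) with hD
  have hDtop : D ≠ ∞ := by
    refine (ENNReal.sum_lt_top.mpr fun j _ => ENNReal.sum_lt_top.mpr fun k _ => ?_).ne
    exact ENNReal.rpow_lt_top_of_nonneg p.coe_nonneg (edist_ne_top _ _)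
  have hmid : Tendsto (fun N : ℕ => ((∑ y : q.range,
      ((empiricalMeasure fun i : Fin N => Y i ω) (q ⁻¹' {y.1}) - m (q ⁻¹' {y.1}))) * D) ^
        (p : ℝ)⁻¹) atTop (𝓝 0) := by
    have h1 : Tendsto (fun N : ℕ => ∑ y : q.range,
        ((empiricalMeasure fun i : Fin N => Y i ω) (q ⁻¹' {y.1}) - m (q ⁻¹' {y.1}))) atTop
          (𝓝 (∑ y : q.range, (m (q ⁻¹' {y.1}) - m (q ⁻¹' {y.1})))) :=
      tendsto_finsetSum _ fun y _ => ENNReal.Tendsto.sub (hw n y) tendsto_const_nhds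
        (Or.inl (measure_ne_top _ _))
    simp only [tsub_self, Finset.sum_const_zero] at h1
    have h2 := (ENNReal.Tendsto.mul_const h1 (Or.inr hDtop)).ennrpow_const (p : ℝ)⁻¹
    simpa [hp0] using h2
  have htot := ((hc n).add hmid).add
    (tendsto_const_nhds (x := lpMean p m fun x => edist x (q x)))
  filter_upwards [htot.eventually_lt_const hn, eventually_ne_atTop 0] with N hN hN0
  refine le_trans ?_ hN.le
  set LN := empiricalMeasure fun i : Fin N => Y i ω
  have := isProbabilityMeasure_empiricalMeasure hN0 fun i : Fin N => Y i ω
  have hLNp : IsProbabilityMeasure (LN.map q) :=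
    Measure.isProbabilityMeasure_map (hq n).aemeasurable
  have hmp : IsProbabilityMeasure (m.map q) :=
    Measure.isProbabilityMeasure_map (hq n).aemeasurable
  refine (wasserstein_triangle hp _ (m.map q) _).trans (add_le_add
    ((wasserstein_triangle hp _ (LN.map q) _).trans (add_le_add ?_ ?_)) ?_)
  · exact wasserstein_map_le LN (hq n)
  · have hone : ∀ μ : Measure E, IsProbabilityMeasure (μ.map q) →
        ∑ y : q.range, μ (q ⁻¹' {y.1}) = 1 := fun μ hμ => by
      have := measure_univ (μ := μ.map q)
      rw [map_simpleFunc_eq_sum q (hq n)] at this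
      simpa using this
    have h := ENNReal.rpow_le_rpow (z := (p : ℝ)⁻¹) (wasserstein_sum_dirac_le hp
      (fun y : q.range => y.1) (fun y => LN (q ⁻¹' {y.1})) (fun y => m (q ⁻¹' {y.1}))
      (hone _ hLNp) (hone _ hmp)) (by positivity)
    rwa [ENNReal.rpow_rpow_inv hp0.ne', ← map_simpleFunc_eq_sum q (hq n),
      ← map_simpleFunc_eq_sum q (hq n)] at h
  · rw [wasserstein_comm]
    exact wasserstein_map_le m (hq n)

/-! ### Independence and conditional laws -/

section Independence

variable {Ω α β γ δ : Type*} [MeasurableSpace Ω] [MeasurableSpace α] [MeasurableSpace β]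
  [MeasurableSpace γ] [MeasurableSpace δ] {P : Measure Ω} [IsProbabilityMeasure P]

/-- Regrouping two independent pairs that are independent of each other. -/
lemma indepFun_prodMk_prodMk_of_indepFun {f : Ω → α} {f' : Ω → β} {g : Ω → γ} {g' : Ω → δ}
    (hf : Measurable f) (hf' : Measurable f') (hg : Measurable g) (hg' : Measurable g')
    (hff' : IndepFun f f' P) (hgg' : IndepFun g g' P)
    (h : IndepFun (fun ω => (f ω, f' ω)) (fun ω => (g ω, g' ω)) P) :
    IndepFun (fun ω => (f ω, g ω)) (fun ω => (f' ω, g' ω)) P := by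
  have := Measure.isProbabilityMeasure_map (μ := P) hf.aemeasurable
  have := Measure.isProbabilityMeasure_map (μ := P) hf'.aemeasurable
  have := Measure.isProbabilityMeasure_map (μ := P) hg.aemeasurable
  have := Measure.isProbabilityMeasure_map (μ := P) hg'.aemeasurable
  have hfg : IndepFun f g P := h.comp measurable_fst measurable_fst
  have hfg' : IndepFun f' g' P := h.comp measurable_snd measurable_snd
  rw [indepFun_iff_map_prod_eq_prod_map_map (by fun_prop) (by fun_prop)] at *
  rw [hfg, hfg']
  rw [hff', hgg'] at h
  have h1 : P.map (fun ω => ((f ω, g ω), (f' ω, g' ω))) =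
      (((P.map f).prod (P.map f')).prod ((P.map g).prod (P.map g'))).map
        fun z => ((z.1.1, z.2.1), (z.1.2, z.2.2)) := by
    rw [← h, Measure.map_map (by fun_prop) (by fun_prop)]; rfl
  rw [h1]
  -- Both sides are fourfold iterated integrals that differ by exchanging the two middle variables.
  refine Measure.ext_of_lintegral _ fun φ hφ => ?_
  rw [lintegral_map hφ (by fun_prop), lintegral_prod _ (by fun_prop), lintegral_prod _
    (by fun_prop), lintegral_prod _ (by fun_prop), lintegral_prod _ (by fun_prop)]
  refine lintegral_congr fun a => ?_
  simp_rw [fun a' => lintegral_prod (μ := P.map g) (ν := P.map g')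
    (fun z : γ × δ => φ ((a, z.1), (a', z.2))) (by fun_prop)]
  rw [lintegral_lintegral_swap (by fun_prop)]
  refine lintegral_congr fun c => ?_
  rw [lintegral_prod _ (by fun_prop)]

/-- The conditional law of a function of two independent random variables. -/
lemma ae_condDistrib_eq_map_of_indepFun {F : Type*} [MeasurableSpace F] [StandardBorelSpace F]
    [Nonempty F] {B : Ω → β} {Y : Ω → γ} (hB : Measurable B) (hY : Measurable Y)
    (h : IndepFun B Y P) {G : β × γ → F} (hG : Measurable G) :
    ∀ᵐ ω ∂P, condDistrib (fun ω => G (B ω, Y ω)) B P (B ω) =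
      (P.map Y).map fun y => G (B ω, y) := by
  have := Measure.isProbabilityMeasure_map (μ := P) hY.aemeasurable
  -- The candidate freezes B at b and averages over Y; uniqueness of disintegration identifies it
  -- with the conditional law.
  let κ : Kernel β F := ⟨fun b => (P.map Y).map fun y => G (b, y), measurable_map_section _ hG⟩
  have hκ : IsMarkovKernel κ :=
    ⟨fun b => Measure.isProbabilityMeasure_map (hG.comp measurable_prodMk_left).aemeasurable⟩
  refine ae_of_ae_map hB.aemeasurable
    (condDistrib_ae_eq_of_measure_eq_compProd (κ := κ) B (by fun_prop) ?_)
  rw [indepFun_iff_map_prod_eq_prod_map_map (by fun_prop) (by fun_prop)] at h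
  have h1 : P.map (fun ω => (B ω, G (B ω, Y ω))) =
      ((P.map B).prod (P.map Y)).map fun z => (z.1, G z) := by
    rw [← h, Measure.map_map (by fun_prop) (by fun_prop)]; rfl
  rw [h1]
  refine Measure.ext_of_lintegral _ fun φ hφ => ?_
  rw [lintegral_map hφ (by fun_prop), lintegral_prod _ (by fun_prop),
    Measure.lintegral_compProd hφ]
  refine lintegral_congr fun x => ?_
  exact (lintegral_map (hφ.comp measurable_prodMk_left) (hG.comp measurable_prodMk_left)).symm

lemma lintegral_lintegral_condDistrib {F : Type*} [MeasurableSpace F] [StandardBorelSpace F]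
    [Nonempty F] {B : Ω → β} {Y : Ω → F} (hB : Measurable B) (hY : Measurable Y)
    {f : F → ℝ≥0∞} (hf : Measurable f) :
    ∫⁻ ω, ∫⁻ y, f y ∂condDistrib Y B P (B ω) ∂P = ∫⁻ ω, f (Y ω) ∂P := by
  rw [← lintegral_map (μ := P) (f := fun b => ∫⁻ y, f y ∂condDistrib Y B P b)
      hf.lintegral_kernel hB,
    ← Measure.lintegral_compProd (f := fun z : β × F => f z.2) (by fun_prop),
    compProd_map_condDistrib hY.aemeasurable,
    lintegral_map (f := fun z : β × F => f z.2) (by fun_prop) (by fun_prop)]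

end Independence

/-! ### Finiteness of L^p means -/

section LpMeanFinite

variable {α : Type*} [MeasurableSpace α] {p : ℝ≥0} {m : Measure α}

lemma lpMean_add_lt_top (hp : 1 ≤ p) {f g : α → ℝ≥0∞} (hfm : Measurable f) (hgm : Measurable g)
    (hf : lpMean p m f < ∞) (hg : lpMean p m g < ∞) : lpMean p m (fun a => f a + g a) < ∞ :=
  (lpMean_add_le hp hfm.aemeasurable hgm.aemeasurable).trans_lt (ENNReal.add_lt_top.mpr ⟨hf, hg⟩)

lemma lpMean_sum_lt_top [IsProbabilityMeasure m] (hp : 1 ≤ p) {J : Type*} (s : Finset J)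
    {f : J → α → ℝ≥0∞} (hfm : ∀ j, Measurable (f j)) (hf : ∀ j, lpMean p m (f j) < ∞) :
    lpMean p m (fun a => ∑ j ∈ s, f j a) < ∞ := by
  classical
  induction s using Finset.induction_on with
  | empty => simp [lpMean_const hp]
  | insert j s hj ih =>
    simp_rw [Finset.sum_insert hj]
    exact lpMean_add_lt_top hp (hfm j) (Finset.measurable_fun_sum s fun j _ => hfm j) (hf j) ih

lemma lpMean_const_mul_lt_top (hp : 1 ≤ p) {c : ℝ≥0∞} (hc : c < ∞) {f : α → ℝ≥0∞}
    (hfm : Measurable f) (hf : lpMean p m f < ∞) : lpMean p m (fun a => c * f a) < ∞ := by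
  rw [lpMean_const_mul hp _ hfm.aemeasurable]
  exact ENNReal.mul_lt_top hc hf

lemma lpMean_const_lt_top [IsProbabilityMeasure m] (hp : 1 ≤ p) {c : ℝ≥0∞} (hc : c < ∞) :
    lpMean p m (fun _ => c) < ∞ := by
  rwa [lpMean_const hp]

end LpMeanFinite

/-! ### Particle solutions, and uniqueness for the conditional equation -/

section Solutions

variable {Ω : Type*} [MeasurableSpace Ω] {P : Measure Ω} {d : ℕ} {T : ℝ}
  {p : ℝ≥0} {b : Set.Icc (0 : ℝ) T → EuclideanSpace ℝ (Fin d) →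
    PMeasure p (EuclideanSpace ℝ (Fin d)) → EuclideanSpace ℝ (Fin d)} {L : ℝ≥0}

/-- The path started at a point and driven by a path. -/
def inputPath (z : EuclideanSpace ℝ (Fin d) × PathSpace d T) : PathSpace d T :=
  ContinuousMap.const _ z.1 + z.2

@[fun_prop]
lemma measurable_inputPath : Measurable (inputPath (d := d) (T := T)) := by
  refine Continuous.measurable ?_
  unfold inputPath
  exact (ContinuousMap.continuous_const'.comp continuous_fst).add continuous_snd

lemma enorm_inputPath_le (z : EuclideanSpace ℝ (Fin d) × PathSpace d T) :
    ‖inputPath z‖ₑ ≤ ‖z.1‖ₑ + ‖z.2‖ₑ := by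
  refine (enorm_add_le (ContinuousMap.const _ z.1) z.2).trans (add_le_add ?_ le_rfl)
  rw [enorm_le_iff_norm_le]
  exact (ContinuousMap.norm_le _ (norm_nonneg _)).mpr fun _ => le_rfl

lemma memLp_of_enorm_le (hp : 1 ≤ p) {F : Type*} [NormedAddCommGroup F] {f : Ω → F}
    (hf : AEStronglyMeasurable f P) {g : Ω → ℝ≥0∞} (h : ∀ ω, ‖f ω‖ₑ ≤ g ω)
    (hg : lpMean p P g < ∞) : MemLp f p P :=
  (memLp_iff_lpMean_lt_top hp hf).mpr ((lpMean_mono h).trans_lt hg)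

lemma lpMean_inputPath_lt_top (hp : 1 ≤ p) {ζ : Ω → EuclideanSpace ℝ (Fin d)}
    {W : Ω → PathSpace d T} (hζ : Measurable ζ) (hW : Measurable W) (hζp : MemLp ζ p P)
    (hWp : MemLp W p P) : lpMean p P (fun ω => ‖inputPath (ζ ω, W ω)‖ₑ) < ∞ :=
  (lpMean_mono fun ω => enorm_inputPath_le (ζ ω, W ω)).trans_lt
    (lpMean_add_lt_top hp hζ.enorm hW.enorm ((memLp_iff_lpMean_lt_top hp hζp.1).mp hζp)
      ((memLp_iff_lpMean_lt_top hp hWp.1).mp hWp))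

variable [IsProbabilityMeasure P]

/-- Existence for the particle system. -/
theorem exists_isParticleSolution (hb : LipschitzDrift L b) (hp : 1 ≤ p) {N : ℕ} [NeZero N]
    {ζ : Fin N → Ω → EuclideanSpace ℝ (Fin d)} {W : Fin N → Ω → PathSpace d T}
    {B : Ω → PathSpace d T} (hζ : ∀ i, Measurable (ζ i)) (hW : ∀ i, Measurable (W i))
    (hB : Measurable B) (hζp : ∀ i, MemLp (ζ i) p P) (hWp : ∀ i, MemLp (W i) p P)
    (hBp : MemLp B p P) : ∃ X, IsParticleSolution P b ζ W B X := by
  -- The index plays the role of chance and ω that of the parameter, so the law of the family at ω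
  -- is the empirical measure of the particles.
  set m : Measure (Fin N) := empiricalMeasure id
  have hm : IsProbabilityMeasure m := isProbabilityMeasure_empiricalMeasure (NeZero.ne N) id
  let z : Ω × Fin N → PathSpace d T := fun a => inputPath (ζ a.2 a.1, W a.2 a.1) + B a.1
  have hzi : ∀ i, Measurable fun ω => z (ω, i) := fun i => by
    have := hζ i; have := hW i
    change Measurable fun ω => inputPath (ζ i ω, W i ω) + B ω
    fun_prop
  let Z : PathFamily d T p Ω m := ⟨z, measurable_from_prod_countable_left hzi, fun ω => by
    rw [lpMean_lt_top_iff hp, lintegral_empiricalMeasure _ (measurable_of_finite _)]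
    refine ENNReal.mul_lt_top (ENNReal.inv_lt_top.mpr (Nat.cast_pos.mpr (NeZero.pos N)))
      (ENNReal.sum_lt_top.mpr fun i _ => ?_)
    exact ENNReal.rpow_lt_top_of_nonneg p.coe_nonneg enorm_ne_top⟩
  obtain ⟨X, hX, hbound⟩ := PathFamily.exists_isIntegralPath hb hp Z
  have hXm : ∀ i, Measurable fun ω => X.path (ω, i) := fun i =>
    X.measurable.comp measurable_prodMk_right
  refine ⟨fun i ω => X.path (ω, i), hXm, fun i => ?_, ae_of_all _ fun ω i => ?_⟩
  · set c := ‖PathFamily.basePath hb hp‖ₑ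
    have hc : c < ∞ := enorm_lt_top
    set U : Fin N → Ω → ℝ≥0∞ := fun j ω => ‖z (ω, j)‖ₑ + c
    have hUm : ∀ j, Measurable (U j) := fun j => (hzi j).enorm.add_const c
    have hU : ∀ j, lpMean p P (U j) < ∞ := fun j => by
      refine lpMean_add_lt_top hp (hzi j).enorm measurable_const ?_ (lpMean_const_lt_top hp hc)
      have hI := lpMean_inputPath_lt_top hp (hζ j) (hW j) (hζp j) (hWp j)
      have := hζ j; have := hW j
      exact (lpMean_mono fun ω => enorm_add_le (inputPath (ζ j ω, W j ω)) (B ω)).trans_lt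
        (lpMean_add_lt_top hp (by fun_prop) hB.enorm hI
          ((memLp_iff_lpMean_lt_top hp hBp.1).mp hBp))
    have hS : Measurable fun ω => ∑ j, U j ω := Finset.measurable_fun_sum _ fun j _ => hUm j
    refine memLp_of_enorm_le hp (hXm i).aestronglyMeasurable
      (g := fun ω => 2 * (ENNReal.ofReal (Real.exp (4 * L * T)) * (U i ω + ∑ j, U j ω)))
      (fun ω => (hbound ω i).trans ?_) ?_
    · gcongr
      -- The mean over indices is bounded by the sum over all particles, which no longer depends on
      -- the index and has a finite L^p mean over ω.
      calc _ ≤ lpMean p m fun _ => ∑ j, U j ω := lpMean_mono fun j =>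
            Finset.single_le_sum (f := fun j => U j ω) (fun _ _ => zero_le) (Finset.mem_univ j)
        _ = ∑ j, U j ω := lpMean_const hp _
    · exact lpMean_const_mul_lt_top hp ENNReal.ofNat_lt_top
        (((hUm i).add hS).const_mul _) (lpMean_const_mul_lt_top hp ENNReal.ofReal_lt_top
          ((hUm i).add hS) (lpMean_add_lt_top hp (hUm i) hS (hU i)
            (lpMean_sum_lt_top hp _ hUm hU)))
  · rw [solvesIntegralEq_iff]
    have h := hX (ω, i)
    have hlaw : ∀ s, (X.law hp ω).marginal s = empirical p fun j => X.path (ω, j) s := fun s => by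
      refine PMeasure.ext_toMeasure ?_
      change (m.map fun j => X.path (ω, j)).map (fun γ => γ s) = empiricalMeasure _
      rw [map_empiricalMeasure _ (measurable_of_finite _),
        map_empiricalMeasure _ (continuous_eval_const s).measurable]
      rfl
    simp only [hlaw] at h
    exact h

/-- Two `L^p` solutions of the conditional McKean-Vlasov equation with the same data agree. -/
theorem IsConditionalMcKeanVlasovSolution.ae_eq (hb : LipschitzDrift L b) (hp : 1 ≤ p)
    {ζ : Ω → EuclideanSpace ℝ (Fin d)} {W B X X' : Ω → PathSpace d T} (hB : Measurable B)
    (hX : IsConditionalMcKeanVlasovSolution P b ζ W B X)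
    (hX' : IsConditionalMcKeanVlasovSolution P b ζ W B X') : X =ᵐ[P] X' := by
  have hp0 : 0 < (p : ℝ) := by positivity
  have hl : 0 ≤ 4 * (L : ℝ) := by positivity
  have hXm := hX.measurable
  have hX'm := hX'.measurable
  -- The joint conditional law couples the two conditional laws that enter the drifts.
  set κ := condDistrib (fun ω => (X ω, X' ω)) B P with hκ
  have hfst : ∀ᵐ ω ∂P, (κ (B ω)).map Prod.fst = condDistrib X B P (B ω) := by
    filter_upwards [ae_of_ae_map hB.aemeasurable (condDistrib_comp (μ := P) B
      (Y := fun ω => (X ω, X' ω)) (by fun_prop) measurable_fst)] with ω hω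
    rw [← Kernel.map_apply _ measurable_fst, ← hω]; rfl
  have hsnd : ∀ᵐ ω ∂P, (κ (B ω)).map Prod.snd = condDistrib X' B P (B ω) := by
    filter_upwards [ae_of_ae_map hB.aemeasurable (condDistrib_comp (μ := P) B
      (Y := fun ω => (X ω, X' ω)) (by fun_prop) measurable_snd)] with ω hω
    rw [← Kernel.map_apply _ measurable_snd, ← hω]; rfl
  have hwm := measurable_weightedDist (d := d) (T := T) (4 * L)
  set ρ : Ω → ℝ≥0∞ := fun ω => weightedDist (4 * L) (X ω) (X' ω) with hρ
  set r : Ω → ℝ≥0∞ := fun ω => lpMean p (κ (B ω)) fun z => weightedDist (4 * L) z.1 z.2 with hr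
  have hρm : Measurable ρ := measurable_weightedDist_comp hXm hX'm
  have hrm : Measurable r :=
    ((Measurable.lintegral_kernel (κ := κ) (hwm.pow_const _)).comp hB).pow_const _
  -- The contraction gives ρ ≤ (ρ + r)/4, hence ρ ≤ r/3; the weaker constant 1/2 suffices.
  have hle : ∀ᵐ ω ∂P, ρ ω ≤ 2⁻¹ * r ω := by
    filter_upwards [hX.solves, hX'.solves, hfst, hsnd] with ω ⟨μ, hμ, hs⟩ ⟨μ', hμ', hs'⟩ h₁ h₂
    rw [solvesIntegralEq_iff] at hs hs'
    have h := hb.weightedDist_le hs hs' (wasserstein_marginal_le hp measurable_fst measurable_snd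
      (h₁.trans hμ.symm) (h₂.trans hμ'.symm))
    rw [edist_self, zero_add] at h
    change ρ ω ≤ (ρ ω + r ω) / 4 at h
    have hρtop : ρ ω ≠ ∞ :=
      ((weightedDist_le_edist hl (X ω) (X' ω)).trans_lt (edist_lt_top _ _)).ne
    rcases eq_or_ne (r ω) ∞ with hrt | hrt
    · rw [hrt, ENNReal.mul_top (by simp)]; exact le_top
    · rw [← ENNReal.toReal_le_toReal hρtop (by finiteness)] at h ⊢
      rw [ENNReal.toReal_div, ENNReal.toReal_add hρtop hrt] at h
      rw [ENNReal.toReal_mul, ENNReal.toReal_inv]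
      have : 0 ≤ (r ω).toReal := ENNReal.toReal_nonneg
      norm_num at h ⊢
      linarith
  -- By the tower property, averaging the conditional mean r over B recovers the mean of ρ. The
  -- pointwise bound then makes a finite number at most half of itself.
  have hmean : lpMean p P r = lpMean p P ρ := by
    have h := lintegral_lintegral_condDistrib (P := P) (Y := fun ω => (X ω, X' ω)) hB
      (by fun_prop) (hwm.pow_const (p : ℝ))
    rw [lpMean, lpMean]
    congr 1
    simp_rw [hr, lpMean_rpow hp]
    exact h
  have hfin : lpMean p P ρ < ∞ := lpMean_weightedDist_lt_top hp hXm hX'm hl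
    ((memLp_iff_lpMean_lt_top hp hX.memLp.1).mp hX.memLp)
    ((memLp_iff_lpMean_lt_top hp hX'.memLp.1).mp hX'.memLp)
  have hzero : lpMean p P ρ = 0 := by
    have h : lpMean p P ρ ≤ 2⁻¹ * lpMean p P ρ := by
      calc lpMean p P ρ ≤ _ := lpMean_mono_ae hle
        _ = 2⁻¹ * lpMean p P r := lpMean_const_mul hp _ hrm.aemeasurable
        _ = _ := by rw [hmean]
    by_contra h0
    refine absurd h (not_le.mpr ?_)
    rw [mul_comm, ← div_eq_mul_inv]
    exact ENNReal.half_lt_self h0 hfin.ne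
  have h0 : ∫⁻ ω, ρ ω ^ (p : ℝ) ∂P = 0 := by
    rw [← lpMean_rpow hp, hzero, ENNReal.zero_rpow_of_pos hp0]
  rw [lintegral_eq_zero_iff (hρm.pow_const _)] at h0
  filter_upwards [h0] with ω hω
  have hω' : ρ ω = 0 := by
    simpa [ENNReal.rpow_eq_zero_iff_of_pos hp0] using hω
  have := edist_le_weightedDist hl (X ω) (X' ω)
  change _ ≤ _ * ρ ω at this
  rw [hω', mul_zero] at this
  exact edist_le_zero.mp this

end Solutions

/-! ### Existence for the conditional equation, and transfer of convergence -/

section Convergence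

variable {Ω : Type*} [MeasurableSpace Ω] {P : Measure Ω} [IsProbabilityMeasure P] {d : ℕ} {T : ℝ}
  {p : ℝ≥0} {b : Set.Icc (0 : ℝ) T → EuclideanSpace ℝ (Fin d) →
    PMeasure p (EuclideanSpace ℝ (Fin d)) → EuclideanSpace ℝ (Fin d)} {L : ℝ≥0}

/-- Existence for the conditional McKean-Vlasov equation: given `B = β`, the solution is a
function of the idiosyncratic input that solves the McKean-Vlasov equation with input shifted
by `β`. -/
theorem exists_isConditionalMcKeanVlasovSolution (hb : LipschitzDrift L b) (hp : 1 ≤ p)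
    {ζ : Ω → EuclideanSpace ℝ (Fin d)} {W B : Ω → PathSpace d T} (hζ : Measurable ζ)
    (hW : Measurable W) (hB : Measurable B) (hζp : MemLp ζ p P) (hWp : MemLp W p P)
    (hBp : MemLp B p P) (hindep : IndepFun B (fun ω => inputPath (ζ ω, W ω)) P)
    {m : Measure (PathSpace d T)} [IsProbabilityMeasure m]
    (hm : P.map (fun ω => inputPath (ζ ω, W ω)) = m) :
    ∃ (G : PathSpace d T → PathSpace d T → PathSpace d T)
      (μ : PathSpace d T → PMeasure p (PathSpace d T)) (X : Ω → PathSpace d T),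
      (∀ β, Measurable (G β)) ∧ (∀ β, m.map (G β) = (μ β).toMeasure) ∧
      (∀ β y, IsIntegralPath (y + β) (fun s => b s (G β y s) ((μ β).marginal s)) (G β y)) ∧
      (∀ᵐ ω ∂P, condDistrib X B P (B ω) = (μ (B ω)).toMeasure) ∧
      IsConditionalMcKeanVlasovSolution P b ζ W B X := by
  have hYm : Measurable fun ω => inputPath (ζ ω, W ω) := by fun_prop
  have hYp := lpMean_inputPath_lt_top hp hζ hW hζp hWp
  have hBp' := (memLp_iff_lpMean_lt_top hp hBp.1).mp hBp
  set M := lpMean p P fun ω => ‖inputPath (ζ ω, W ω)‖ₑ with hM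
  have hmM : lpMean p m (fun y => ‖y‖ₑ) = M := by
    rw [← hm, lpMean_map (by fun_prop) hYm]
  have hsum : ∀ β : PathSpace d T, lpMean p m (fun y => ‖y + β‖ₑ) ≤ M + ‖β‖ₑ := fun β => by
    refine (lpMean_mono fun y => enorm_add_le y β).trans
      ((lpMean_add_le hp (by fun_prop) (by fun_prop)).trans ?_)
    rw [lpMean_const hp, hmM]
  let Z : PathFamily d T p (PathSpace d T) m := ⟨fun a => a.2 + a.1, by fun_prop, fun β =>
    (hsum β).trans_lt (ENNReal.add_lt_top.mpr ⟨hYp, enorm_lt_top⟩)⟩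
  obtain ⟨G, hG, hbound⟩ := PathFamily.exists_isIntegralPath hb hp Z
  set X : Ω → PathSpace d T := fun ω => G.path (B ω, inputPath (ζ ω, W ω)) with hX
  have hXm : Measurable X := G.measurable.comp (hB.prodMk hYm)
  -- Independence of B and the input lets B be frozen, so the conditional law is the law solving the
  -- equation with parameter β = B(ω).
  have hcond : ∀ᵐ ω ∂P, condDistrib X B P (B ω) = (G.law hp (B ω)).toMeasure := by
    filter_upwards [ae_condDistrib_eq_map_of_indepFun hB hYm hindep G.measurable] with ω hω
    rw [hm] at hω
    exact hω
  refine ⟨fun β y => G.path (β, y), G.law hp, X, fun β => G.measurable_section β, fun β => rfl,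
    fun β y => hG (β, y), hcond, hXm, ?_, ?_⟩
  · set c := ‖PathFamily.basePath hb hp‖ₑ
    have hc : c < ∞ := enorm_lt_top
    set U : Ω → ℝ≥0∞ := fun ω => (‖inputPath (ζ ω, W ω)‖ₑ + ‖B ω‖ₑ + c) + (M + ‖B ω‖ₑ + c)
    have h1 : Measurable fun ω => ‖inputPath (ζ ω, W ω)‖ₑ + ‖B ω‖ₑ := hYm.enorm.add hB.enorm
    have h2 : Measurable fun ω => M + ‖B ω‖ₑ := hB.enorm.const_add M
    have hUm : Measurable U := (h1.add_const c).add (h2.add_const c)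
    have hU : lpMean p P U < ∞ :=
      lpMean_add_lt_top hp (h1.add_const c) (h2.add_const c)
        (lpMean_add_lt_top hp h1 measurable_const
          (lpMean_add_lt_top hp hYm.enorm hB.enorm hYp hBp') (lpMean_const_lt_top hp hc))
        (lpMean_add_lt_top hp h2 measurable_const
          (lpMean_add_lt_top hp measurable_const hB.enorm (lpMean_const_lt_top hp hYp) hBp')
          (lpMean_const_lt_top hp hc))
    refine memLp_of_enorm_le hp hXm.aestronglyMeasurable
      (g := fun ω => 2 * (ENNReal.ofReal (Real.exp (4 * L * T)) * U ω))
      (fun ω => (hbound _ _).trans ?_)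
      (lpMean_const_mul_lt_top hp ENNReal.ofNat_lt_top (hUm.const_mul _)
        (lpMean_const_mul_lt_top hp ENNReal.ofReal_lt_top hUm hU))
    gcongr
    refine add_le_add (add_le_add (enorm_add_le (inputPath (ζ ω, W ω)) (B ω)) le_rfl) ?_
    refine (lpMean_add_le hp (by fun_prop) aemeasurable_const).trans ?_
    rw [lpMean_const hp]
    exact add_le_add (hsum (B ω)) le_rfl
  · filter_upwards [hcond] with ω hω
    refine ⟨G.law hp (B ω), hω.symm, ?_⟩
    rw [solvesIntegralEq_iff]
    exact hG (B ω, inputPath (ζ ω, W ω))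

/-- The distance of the empirical measure of the particles to the law of the solution of the
McKean-Vlasov equation is controlled by the distance of the inputs. -/
theorem LipschitzDrift.wasserstein_empiricalMeasure_le (hb : LipschitzDrift L b) (hp : 1 ≤ p)
    {N : ℕ} [NeZero N] {y x : Fin N → PathSpace d T} {β : PathSpace d T}
    {G : PathSpace d T → PathSpace d T} (hG : Measurable G) {m : Measure (PathSpace d T)}
    {μ : PMeasure p (PathSpace d T)} (hμ : m.map G = μ.toMeasure)
    (hx : ∀ i, IsIntegralPath (y i + β)
      (fun s => b s (x i s) (empirical p fun j => x j s)) (x i))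
    (hGsol : ∀ z, IsIntegralPath (z + β) (fun s => b s (G z s) (μ.marginal s)) (G z))
    {δ : ℝ≥0∞} (hδ : wasserstein p (empiricalMeasure y) m < δ) :
    wasserstein p (empiricalMeasure x) μ.toMeasure ≤
      ENNReal.ofReal (Real.exp (4 * L * T)) * (2 * δ) := by
  have hm := isProbabilityMeasure_of_map hG hμ
  have := isProbabilityMeasure_empiricalMeasure (NeZero.ne N) y
  have := isProbabilityMeasure_empiricalMeasure (NeZero.ne N) x
  set u : Measure (Fin N) := empiricalMeasure id with hu
  have hup : IsProbabilityMeasure u := isProbabilityMeasure_empiricalMeasure (NeZero.ne N) id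
  have hmap : ∀ {F : Type} [MeasurableSpace F] (f : Fin N → F), u.map f = empiricalMeasure f :=
    fun f => map_empiricalMeasure id (measurable_of_finite f)
  obtain ⟨γ, hγ₁, hγ₂, hγ⟩ := exists_coupling_of_wasserstein_lt hp hδ
  have hγp := isProbabilityMeasure_of_map measurable_fst hγ₁
  have hgraph : Measurable fun i : Fin N => (i, y i) := measurable_of_finite _
  -- The index is kept in the coupling because x i is a function of i and not of y i: distinct
  -- particles may have equal inputs.
  obtain ⟨π, hπ₁, hπ₂⟩ := exists_gluing (u.map fun i => (i, y i)) γ (by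
    rw [Measure.map_map measurable_snd hgraph, hγ₁]
    exact hmap y)
  have hπfst : π.map Prod.fst = u := by
    have h : π.map Prod.fst = (π.map fun z => (z.1, z.2.1)).map Prod.fst := by
      rw [Measure.map_map measurable_fst (by fun_prop)]; rfl
    rw [h, hπ₁, Measure.map_map measurable_fst hgraph]
    exact Measure.map_id
  have hπsnd : π.map (fun z => z.2.2) = m := by
    rw [← hγ₂, ← hπ₂, Measure.map_map measurable_snd measurable_snd]; rfl
  have hae : ∀ᵐ z ∂π, z.2.1 = y z.1 := by
    have hset : MeasurableSet {w : Fin N × PathSpace d T | w.2 = y w.1} :=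
      measurableSet_eq_fun measurable_snd ((measurable_of_finite y).comp measurable_fst)
    have h : ∀ᵐ w ∂π.map (fun z => (z.1, z.2.1)), w.2 = y w.1 := by
      rw [hπ₁, ae_map_iff hgraph.aemeasurable hset]
      exact ae_of_all _ fun _ => rfl
    exact ae_of_ae_map (by fun_prop) h
  let ν : PMeasure p (PathSpace d T) := ⟨empiricalMeasure x, inferInstance, by
    rw [lintegral_empiricalMeasure _ (by fun_prop)]
    refine ENNReal.mul_lt_top (ENNReal.inv_lt_top.mpr (Nat.cast_pos.mpr (NeZero.pos N)))
      (ENNReal.sum_lt_top.mpr fun i _ => ?_)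
    exact ENNReal.rpow_lt_top_of_nonneg p.coe_nonneg enorm_ne_top⟩
  have hν : ∀ s, ν.marginal s = empirical p fun j => x j s := fun s =>
    PMeasure.ext_toMeasure (map_empiricalMeasure x (continuous_eval_const s).measurable)
  have hxm : Measurable fun z : Fin N × PathSpace d T × PathSpace d T => x z.1 :=
    (measurable_of_finite x).comp measurable_fst
  have hym : Measurable fun z : Fin N × PathSpace d T × PathSpace d T => y z.1 :=
    (measurable_of_finite y).comp measurable_fst
  -- Stability on the glued space: a particle with random index against the limit solution fed with
  -- the coupled input. The common shift β cancels in the distance of the inputs.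
  refine (hb.wasserstein_le hp (π := π) (z := fun z => y z.1 + β) (z' := fun z => z.2.2 + β)
    (x := fun z => x z.1) (x' := fun z => G z.2.2) (μ := ν) (μ' := μ) (by fun_prop) (by fun_prop)
    hxm (hG.comp (by fun_prop)) ?_ ?_ (ae_of_all _ fun z => ?_)
    (ae_of_all _ fun z => hGsol z.2.2)).trans ?_
  · have h := Measure.map_map (μ := π) (measurable_of_finite x) measurable_fst
    rw [hπfst, hmap x] at h
    exact h.symm
  · rw [← hμ, ← hπsnd, Measure.map_map hG (by fun_prop)]; rfl
  · simp only [hν]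
    exact hx z.1
  · gcongr
    refine le_trans ?_ hγ.le
    rw [← hπ₂, lpMean_map measurable_edist measurable_snd]
    refine lpMean_mono_ae (hae.mono fun z hz => ?_)
    rw [hz, edist_add_right]

end Convergence

end

/-! ### The theorem -/

theorem mainTheorem9 {Ω : Type*} [MeasurableSpace Ω] (P : Measure Ω) [IsProbabilityMeasure P]
    (d : ℕ) (T : ℝ) (hT : 0 < T) (p p' : ℝ≥0) (hp : 1 ≤ p) (hpp' : p < p')
    (b : Set.Icc (0 : ℝ) T → EuclideanSpace ℝ (Fin d) →
      PMeasure p (EuclideanSpace ℝ (Fin d)) → EuclideanSpace ℝ (Fin d))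
    (hb : DriftAssumption b)
    (hb_int : ∃ x μ, Integrable (fun t => b t x μ) (timeMeasure T))
    (ζ : ℕ → Ω → EuclideanSpace ℝ (Fin d)) (W : ℕ → Ω → PathSpace d T)
    (ζbar : Ω → EuclideanSpace ℝ (Fin d)) (Wbar B : Ω → PathSpace d T)
    (hζ_meas : ∀ i, Measurable (ζ i)) (hW_meas : ∀ i, Measurable (W i))
    (hζbar_meas : Measurable ζbar) (hWbar_meas : Measurable Wbar) (hB_meas : Measurable B)
    (hζ_Lp : ∀ i, MemLp (ζ i) p' P) (hW_Lp : ∀ i, MemLp (W i) p' P) (hB_Lp : MemLp B p P)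
    (hζ_indep : iIndepFun ζ P) (hζ_ident : ∀ i, IdentDistrib (ζ i) (ζ 0) P P)
    (hW_indep : iIndepFun W P) (hW_ident : ∀ i, IdentDistrib (W i) (W 0) P P)
    (hζW_indep : IndepFun (fun ω i => ζ i ω) (fun ω i => W i ω) P)
    (hζbar : IdentDistrib ζbar (ζ 0) P P) (hWbar : IdentDistrib Wbar (W 0) P P)
    (hbar_indep : IndepFun ζbar Wbar P)
    (hB_indep : IndepFun B
      (fun ω => ((fun i => ζ i ω), (fun i => W i ω), ζbar ω, Wbar ω)) P) :
    (∀ (N : ℕ) [NeZero N], ∃ X : Fin N → Ω → PathSpace d T,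
      IsParticleSolution P b (fun i => ζ i) (fun i => W i) B X) ∧
    (∃ Xbar : Ω → PathSpace d T, IsConditionalMcKeanVlasovSolution P b ζbar Wbar B Xbar) ∧
    ∀ (X : ∀ N : ℕ, Fin N → Ω → PathSpace d T) (Xbar : Ω → PathSpace d T),
      (∀ (N : ℕ) [NeZero N],
        IsParticleSolution P b (fun i => ζ i) (fun i => W i) B (X N)) →
      IsConditionalMcKeanVlasovSolution P b ζbar Wbar B Xbar →
      ∀ᵐ ω ∂P, Tendsto
        (fun N : ℕ => wasserstein p (empiricalMeasure fun i => X N i ω)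
          (condDistrib Xbar B P (B ω))) atTop (𝓝 0) := by
  obtain ⟨L, hL⟩ := hb.exists_lipschitzDrift hp hb_int
  have hpp : (p : ℝ≥0∞) ≤ p' := by exact_mod_cast hpp'.le
  have hζp : ∀ i, MemLp (ζ i) p P := fun i => (hζ_Lp i).mono_exponent hpp
  have hWp : ∀ i, MemLp (W i) p P := fun i => (hW_Lp i).mono_exponent hpp
  have hζbarp : MemLp ζbar p P := hζbar.memLp_iff.mpr (hζp 0)
  have hWbarp : MemLp Wbar p P := hWbar.memLp_iff.mpr (hWp 0)
  let Y : ℕ → Ω → PathSpace d T := fun i ω => inputPath (ζ i ω, W i ω)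
  have hYm : ∀ i, Measurable (Y i) := fun i => by
    have := hζ_meas i; have := hW_meas i
    fun_prop
  have hζWi : ∀ i, IndepFun (ζ i) (W i) P := fun i =>
    hζW_indep.comp (measurable_pi_apply i) (measurable_pi_apply i)
  have hlaw : ∀ {ζ' : Ω → EuclideanSpace ℝ (Fin d)} {W' : Ω → PathSpace d T},
      IdentDistrib ζ' (ζ 0) P P → IdentDistrib W' (W 0) P P → IndepFun ζ' W' P →
      IdentDistrib (fun ω => inputPath (ζ' ω, W' ω)) (Y 0) P P := fun h₁ h₂ h₃ =>
    (h₁.prodMk h₂ h₃ (hζWi 0)).comp measurable_inputPath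
  have hYident : ∀ i, IdentDistrib (Y i) (Y 0) P P := fun i =>
    hlaw (hζ_ident i) (hW_ident i) (hζWi i)
  have hYindep : Pairwise fun i j => IndepFun (Y i) (Y j) P := fun i j hij => by
    refine IndepFun.comp (indepFun_prodMk_prodMk_of_indepFun (hζ_meas i) (hζ_meas j) (hW_meas i)
      (hW_meas j) (hζ_indep.indepFun hij) (hW_indep.indepFun hij) ?_)
      measurable_inputPath measurable_inputPath
    exact hζW_indep.comp (φ := fun s => (s i, s j)) (ψ := fun s => (s i, s j))
      (by fun_prop) (by fun_prop)
  set m : Measure (PathSpace d T) := P.map (Y 0) with hm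
  have hmp : IsProbabilityMeasure m := Measure.isProbabilityMeasure_map (hYm 0).aemeasurable
  have hBY : IndepFun B (fun ω => inputPath (ζbar ω, Wbar ω)) P := by
    have hψ : Measurable fun z : (ℕ → EuclideanSpace ℝ (Fin d)) × (ℕ → PathSpace d T) ×
        EuclideanSpace ℝ (Fin d) × PathSpace d T => inputPath (z.2.2.1, z.2.2.2) := by fun_prop
    exact hB_indep.comp measurable_id hψ
  obtain ⟨G, μ, X₀, hGm, hμ, hGsol, hcond, hX₀⟩ :=
    exists_isConditionalMcKeanVlasovSolution hL hp hζbar_meas hWbar_meas hB_meas hζbarp hWbarp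
      hB_Lp hBY (m := m) (hlaw hζbar hWbar hbar_indep).map_eq
  refine ⟨fun N _ => exists_isParticleSolution hL hp (fun i => hζ_meas i) (fun i => hW_meas i)
    hB_meas (fun i => hζp i) (fun i => hWp i) hB_Lp, ⟨X₀, hX₀⟩, fun X Xbar hX hXbar => ?_⟩
  -- By uniqueness, any solution has the conditional law of the constructed one, which is given by
  -- the parametrised family.
  have hcongr : condDistrib Xbar B P = condDistrib X₀ B P :=
    condDistrib_congr_left (hXbar.ae_eq hL hp hB_meas hX₀)
  -- One event serves all N, as the limit in N is taken for fixed ω; N = 0 carries no condition.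
  have hsolves : ∀ᵐ ω ∂P, ∀ N : ℕ, ∀ [NeZero N], ∀ i : Fin N, IsIntegralPath (Y i ω + B ω)
      (fun s => b s (X N i ω s) (empirical p fun j => X N j ω s)) (X N i ω) := by
    refine ae_all_iff.mpr fun N => ?_
    rcases eq_or_ne N 0 with hN | hN
    · exact ae_of_all _ fun ω h => absurd hN h.out
    · have : NeZero N := ⟨hN⟩
      filter_upwards [(hX N).solves] with ω hω _ i
      exact solvesIntegralEq_iff.mp (hω i)
  have hmoment : lpMean p m (fun x => ‖x‖ₑ) < ∞ := by
    rw [hm, lpMean_map (by fun_prop) (hYm 0)]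
    exact lpMean_inputPath_lt_top hp (hζ_meas 0) (hW_meas 0) (hζp 0) (hWp 0)
  filter_upwards [hsolves, hcond,
    tendsto_wasserstein_empiricalMeasure hp hYm hYindep hYident hmoment] with ω hsol hω hlln
  rw [hcongr, hω]
  set K : ℝ≥0∞ := ENNReal.ofReal (Real.exp (4 * L * T)) * 2 with hK
  have hKtop : K ≠ ∞ := ENNReal.mul_ne_top ENNReal.ofReal_ne_top ENNReal.ofNat_ne_top
  refine ENNReal.tendsto_nhds_zero.mpr fun δ hδ => ?_
  have hpos : 0 < δ / K := ENNReal.div_pos hδ.ne' hKtop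
  filter_upwards [hlln.eventually_lt_const hpos, eventually_ne_atTop 0] with N hN hN0
  have : NeZero N := ⟨hN0⟩
  refine (hL.wasserstein_empiricalMeasure_le hp (hGm (B ω)) (hμ (B ω)) (hsol N)
    (hGsol (B ω)) hN).trans ?_
  rw [← mul_assoc, ← hK]
  exact ENNReal.mul_div_le
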